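/- Let $N\ge 1$, $\sigma\in(0,2)$, $0<m<1$ and $T>0$. For $a\in(N,N+\sigma/m)$ put $\vartheta_a(x)=\big(1+(|x|^2-1)_+^4\big)^{-a/8}$ on $\mathbb R^N$, let $\varTheta$ be the set of these weights, $L^1_{\vartheta}=L^1(\mathbb R^N,\vartheta\,dx)$, and $\rho(x)=(1+|x|^2)^{-(N+\sigma)/2}$. Consider $$\partial_t u+(-\Delta)^{\sigma/2}u^m=0, \qquad (-\Delta)^{\sigma/2}g(x)=C_{N,\sigma}\,\mathrm{P.V.}\!\int_{\mathbb R^N}\frac{g(x)-g(y)}{|x-y|^{N+\sigma}}\,dy,\qquad C_{N,\sigma}=\frac{2^{\sigma-1}\sigma\,\Gamma((N+\sigma)/2)}{\pi^{N/2}\,\Gamma(1-\sigma/2)}.$$ A *weighted solution* in $\mathbb R^N\times(0,T)$ is a function $u\in L^1_{\rm loc}((0,T):L^1_{\rm loc}(\mathbb R^N))$ with $u^m\in L^1_{\rm loc}((0,T):L^1_\rho)$ (where $c^m=|c|^{m-1}c$), with $$\int_0^T\!\!\int_{\mathbb R^N}u\,\partial_t\zeta\,dx\,dt-\int_0^T\!\!\int_{\mathbb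 R^N}u^m(-\Delta)^{\sigma/2}\zeta\,dx\,dt=0\qquad\text{for all }\zeta\in C_c^\infty(\mathbb R^N\times(0,T)),$$ and with $u\in L^1_{\rm loc}((0,T):L^1_\vartheta)$ for some $\vartheta\in\varTheta$. Let $\mathfrak M_\sigma$ be the set of nonnegative Radon measures $\mu$ on $\mathbb R^N$ with $\int\vartheta\,d\mu<\infty$ for some $\vartheta\in\varTheta$. **Theorem.** Let $u$ be a weighted solution in $\mathbb R^N\times(0,T)$ with $u\ge0$ almost everywhere. Then there is a unique nonnegative Radon measure $\mu$ on $\mathbb R^N$ that is the initial trace of $u$ in the vague topology, that is, $$\lim_{t\to0^+}\int_{\mathbb R^N}u(x,t)\varphi(x)\,dx=\int_{\mathbb R^N}\varphi\,d\mu\qquad\text{for all }\varphi\in C_c(\mathbb R^N).$$ Moreover $\mu\in\mathfrak M_\sigma$, and for every $\vartheta\in\varTheta$ with $u\in L^1_{\rm loc}((0,T):L^1_\vartheta)$, $$\lim_{t\to0^+}\int_{\mathbb R^N}u(x,t)\vartheta(x)\,dx=\int_{\mathbb R^N}\vartheta\,d\mu<\infty.$$ Since $u$ is determined only almost everywhere,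 the limits are essential limits: for each of them, $t\to0^+$ outside a Lebesgue null set of times. If $u\in C((0,T):L^1_\vartheta)$ for some $\vartheta\in\varTheta$, then the limits for all $\varphi\in C_c(\mathbb R^N)$ and for this $\vartheta$ hold as $t\to0^+$ through all times. -/

import Mathlib

open MeasureTheory Filter Topology Set
open scoped ContDiff

noncomputable section

namespace FracDiffusion

/-- The normalising constant `C_{N,σ}` of the fractional Laplacian. -/
def fracLapConst (N : ℕ) (σ : ℝ) : ℝ :=
  2 ^ (σ - 1) * |σ| * Real.Gamma ((N + σ) / 2) /
    (Real.pi ^ ((N : ℝ) / 2) * Real.Gamma (1 - σ / 2))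

/-- The fractional Laplacian `(-Δ)^{σ/2} g (x)`, as a principal value integral
(the limit exists for every `g` to which it is applied below, namely for smooth
compactly supported `g`, when `0 < σ < 2`). -/
def fracLaplacian {N : ℕ} (σ : ℝ) (g : EuclideanSpace ℝ (Fin N) → ℝ)
    (x : EuclideanSpace ℝ (Fin N)) : ℝ :=
  fracLapConst N σ *
    limUnder (𝓝[>] (0 : ℝ)) (fun ε : ℝ =>
      ∫ y in {y : EuclideanSpace ℝ (Fin N) | ε < ‖x - y‖},
        (g x - g y) / ‖x - y‖ ^ ((N : ℝ) + σ))

/-- The power `c ^ m = |c| ^ (m - 1) c` of a real number of either sign. -/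
def signedPow (m c : ℝ) : ℝ := Real.sign c * |c| ^ m

/-- The weight `ρ(x) = (1 + |x|²)^{-(N+σ)/2}`. -/
def rhoWeight {N : ℕ} (σ : ℝ) (x : EuclideanSpace ℝ (Fin N)) : ℝ :=
  (1 + ‖x‖ ^ 2) ^ (-(((N : ℝ) + σ) / 2))

/-- The weight `ϑ_a(x) = (1 + (|x|² - 1)₊⁴)^{-a/8}`. The class `Θ` consists of the `ϑ_a` with
`a ∈ weightExponents N σ m`. -/
def theta {N : ℕ} (a : ℝ) (x : EuclideanSpace ℝ (Fin N)) : ℝ :=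
  1 / (1 + (max (‖x‖ ^ 2 - 1) 0) ^ 4) ^ (a / 8)

/-- The admissible exponents `a ∈ (N, N + σ/m)`. -/
def weightExponents (N : ℕ) (σ m : ℝ) : Set ℝ := Ioo (N : ℝ) (N + σ / m)

/-- `f ∈ L¹_loc((0,T) : L¹(ℝ^N, w dx))`. -/
def LocL1Weighted {N : ℕ} (T : ℝ) (w : EuclideanSpace ℝ (Fin N) → ℝ)
    (f : ℝ → EuclideanSpace ℝ (Fin N) → ℝ) : Prop :=
  ∀ s t : ℝ, 0 < s → s < t → t < T →
    IntegrableOn (fun p : ℝ × EuclideanSpace ℝ (Fin N) => f p.1 p.2 * w p.2)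
      (Icc s t ×ˢ univ) volume

/-- `f ∈ L¹_loc((0,T) : L¹_loc(ℝ^N))`. -/
def LocL1Loc {N : ℕ} (T : ℝ) (f : ℝ → EuclideanSpace ℝ (Fin N) → ℝ) : Prop :=
  ∀ s t : ℝ, 0 < s → s < t → t < T →
    ∀ K : Set (EuclideanSpace ℝ (Fin N)), IsCompact K →
      IntegrableOn (fun p : ℝ × EuclideanSpace ℝ (Fin N) => f p.1 p.2) (Icc s t ×ˢ K) volume

/-- `f ∈ C((0,T) : L¹(ℝ^N, w dx))`. -/
def ContL1Weighted {N : ℕ} (T : ℝ) (w : EuclideanSpace ℝ (Fin N) → ℝ)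
    (f : ℝ → EuclideanSpace ℝ (Fin N) → ℝ) : Prop :=
  (∀ t ∈ Ioo 0 T, Integrable (fun x => f t x * w x) volume) ∧
    ∀ t₀ ∈ Ioo 0 T, Tendsto (fun t => ∫ x, |f t x - f t₀ x| * w x) (𝓝 t₀) (𝓝 0)

/-- Test functions: `ζ ∈ C_c^∞(ℝ^N × (0,T))`, with the time variable written first. -/
def IsTestFunction {N : ℕ} (T : ℝ) (ζ : ℝ × EuclideanSpace ℝ (Fin N) → ℝ) : Prop :=
  ContDiff ℝ ∞ ζ ∧ HasCompactSupport ζ ∧ tsupport ζ ⊆ Ioo 0 T ×ˢ univ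

/-- Very weak solutions of `∂ₜu + (-Δ)^{σ/2} u^m = 0` in `ℝ^N × (0,T)`; `u t x` is `u(x,t)`. -/
structure IsVeryWeakSolution {N : ℕ} (σ m T : ℝ)
    (u : ℝ → EuclideanSpace ℝ (Fin N) → ℝ) : Prop where
  locL1 : LocL1Loc T u
  pow_locL1 : LocL1Weighted T (rhoWeight σ) (fun t x => signedPow m (u t x))
  equation : ∀ ζ : ℝ × EuclideanSpace ℝ (Fin N) → ℝ, IsTestFunction T ζ →
    (∫ p in Ioo 0 T ×ˢ (univ : Set (EuclideanSpace ℝ (Fin N))),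
        u p.1 p.2 * deriv (fun s => ζ (s, p.2)) p.1) -
      (∫ p in Ioo 0 T ×ˢ (univ : Set (EuclideanSpace ℝ (Fin N))),
        signedPow m (u p.1 p.2) * fracLaplacian σ (fun x => ζ (p.1, x)) p.2) = 0

/-- Weighted solutions: very weak solutions in `L¹_loc((0,T) : L¹_ϑ)` for some `ϑ ∈ Θ`. -/
def IsWeightedSolution {N : ℕ} (σ m T : ℝ)
    (u : ℝ → EuclideanSpace ℝ (Fin N) → ℝ) : Prop :=
  IsVeryWeakSolution σ m T u ∧ ∃ a ∈ weightExponents N σ m, LocL1Weighted T (theta a) u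

/-- Nonnegative Radon measures on `ℝ^N`: locally finite regular Borel measures. -/
def IsRadon {N : ℕ} (μ : Measure (EuclideanSpace ℝ (Fin N))) : Prop :=
  IsLocallyFiniteMeasure μ ∧ μ.Regular

/-- `𝔐_σ`: the nonnegative Radon measures that integrate some weight `ϑ ∈ Θ`. -/
def traceClass (N : ℕ) (σ m : ℝ) : Set (Measure (EuclideanSpace ℝ (Fin N))) :=
  {μ | IsRadon μ ∧ ∃ a ∈ weightExponents N σ m, Integrable (theta a) μ}

/-- The filter `t → 0⁺` off a Lebesgue null set of times: limits along it are essential limits,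
which is what is meaningful for a function `u` that is determined only almost everywhere. -/
def essZeroRight : Filter ℝ := 𝓝[>] (0 : ℝ) ⊓ ae volume

/-- `u(t) dx → μ` in the vague topology, as `t → 0` along `l`. -/
def VagueLimit {N : ℕ} (l : Filter ℝ) (u : ℝ → EuclideanSpace ℝ (Fin N) → ℝ)
    (μ : Measure (EuclideanSpace ℝ (Fin N))) : Prop :=
  (∀ᶠ t in l, LocallyIntegrable (u t) volume) ∧
    ∀ φ : EuclideanSpace ℝ (Fin N) → ℝ, Continuous φ → HasCompactSupport φ →
      Tendsto (fun t => ∫ x, u t x * φ x) l (𝓝 (∫ x, φ x ∂μ))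

end FracDiffusion

end

/-! Write w_R for `bracketWeight R a`, that is (R² + |x|²)^{-a/2}. Testing the equation with
η(t)ψ(x) shows that the moment ∫ u(t)ψ agrees, for almost every t, with an absolutely continuous
function whose derivative is -∫ u^m (-Δ)^{σ/2}ψ. The fractional Laplacian of a good ψ is bounded by
a multiple of ρ, so everything reduces to controlling ∫ u^m ρ, which is `powMass`, down to t = 0.

Two estimates give this control. For truncations of w_R, the fractional Laplacian is at most C
R^{N-a} ρ when R ≥ 1, uniformly in the truncation (`BracketDecay.abs_fracLaplacian_le_rho`,
`exists_bracketDecay_cutWeight`). Young's inequality gives u^m ρ ≤ u w_1 + (1 + |x|²)^{-a'/2} with N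
+ σ = am + a'(1 - m); the last term is integrable because a < N + σ/m forces a' > N. Hence y = ∫ u
w_1 satisfies |y(t) - y(s)| ≤ C ∫_s^t (y + K), and y stays bounded as t → 0
(`IsVeryWeakSolution.exists_weightedMass_bound`). So `powMass` is bounded, smooth moments are
Lipschitz near t = 0 and have limits there. The bound on y extends this to all of C_c by
approximation, and the Riesz representation theorem produces μ (`exists_initialTrace`).

The factor R^{N-a} yields tightness. For small t < t₁, ∫ u(t)w_R exceeds ∫ u(t₁)w_R by at most a
multiple of R^{N-a}, and both tend to 0 as R → ∞ because a > N
(`IsVeryWeakSolution.exists_uniform_control`). No weighted mass escapes to infinity, so convergence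
passes from C_c to ϑ_a, which is comparable to w_1 (`integrable_theta_and_tendsto`). For continuous
u, density of sets of full measure turns the essential limits into limits. -/

noncomputable section

namespace FracDiffusion

variable {N : ℕ}

local notation "𝔼" => EuclideanSpace ℝ (Fin N)

/-! ### Smooth weights, the Lévy kernel, and their scaling. -/

/-- The smooth weight `(R² + |x|²)^{-a/2}`. -/
def bracketWeight (R a : ℝ) (x : 𝔼) : ℝ := (R ^ 2 + ‖x‖ ^ 2) ^ (-(a / 2))

/-- The second difference `2 ψ(x) - ψ(x + z) - ψ(x - z)`. -/
def secondDiff (ψ : 𝔼 → ℝ) (x z : 𝔼) : ℝ := 2 * ψ x - ψ (x + z) - ψ (x - z)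

/-- The Lévy kernel `min(1, |z|²) |z|^{-N-σ}`, integrable for `0 < σ < 2`. -/
def levyKernel (σ : ℝ) (z : 𝔼) : ℝ := min 1 (‖z‖ ^ 2) / ‖z‖ ^ ((N : ℝ) + σ)

lemma bracketWeight_pos {R : ℝ} (hR : 0 < R) (a : ℝ) (x : 𝔼) : 0 < bracketWeight R a x :=
  Real.rpow_pos_of_pos (by positivity) _

lemma levyKernel_nonneg (σ : ℝ) (z : 𝔼) : 0 ≤ levyKernel σ z := by
  unfold levyKernel; positivity

lemma continuous_bracketWeight {R : ℝ} (hR : 0 < R) (a : ℝ) :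
    Continuous (bracketWeight (N := N) R a) := by
  unfold bracketWeight
  refine Continuous.rpow_const (by fun_prop) fun x => Or.inl ?_
  positivity

lemma integrable_levyKernel (hN : 1 ≤ N) {σ : ℝ} (hσ : 0 < σ) (hσ2 : σ < 2) :
    Integrable (levyKernel (N := N) σ) := by
  have : Nonempty (Fin N) := ⟨⟨0, hN⟩⟩
  have : Nontrivial 𝔼 := inferInstance
  unfold levyKernel
  rw [integrable_fun_norm_addHaar (volume : Measure 𝔼)
    (f := fun y : ℝ => min 1 (y ^ 2) / y ^ ((N : ℝ) + σ))]
  rw [← Ioc_union_Ioi_eq_Ioi zero_le_one, integrableOn_union]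
  have key : ∀ y : ℝ, 0 < y → y ^ (Module.finrank ℝ 𝔼 - 1) • (1 / y ^ ((N : ℝ) + σ))
      = y ^ (-1 - σ) := by
    intro y hy
    have h1 : y ^ (Module.finrank ℝ 𝔼 - 1) = y ^ ((N : ℝ) - 1) := by
      rw [← Real.rpow_natCast]
      congr 1
      simp [Nat.cast_sub hN]
    rw [h1, smul_eq_mul, one_div, ← Real.rpow_neg hy.le, ← Real.rpow_add hy]
    congr 1; ring
  constructor
  · have h := (intervalIntegral.intervalIntegrable_rpow' (a := 0) (b := 1)
      (show -1 < 1 - σ by linarith)).1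
    refine h.congr_fun (fun y hy => ?_) measurableSet_Ioc
    have hy0 : 0 < y := hy.1
    have hm : min 1 (y ^ 2) = y ^ 2 := min_eq_right (by nlinarith [hy.2, hy.1])
    have := key y hy0
    simp only [smul_eq_mul] at this ⊢
    rw [hm, show y ^ (Module.finrank ℝ 𝔼 - 1) * (y ^ 2 / y ^ ((N : ℝ) + σ)) =
      y ^ (2 : ℕ) * (y ^ (Module.finrank ℝ 𝔼 - 1) * (1 / y ^ ((N : ℝ) + σ))) by ring, this,
      ← Real.rpow_natCast, ← Real.rpow_add hy0]
    congr 1; push_cast; ring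
  · have h := integrableOn_Ioi_rpow_of_lt (show -1 - σ < -1 by linarith) zero_lt_one
    refine h.congr_fun (fun y hy => ?_) measurableSet_Ioi
    have hy1 : 1 < y := hy
    have hm : min 1 (y ^ 2) = 1 := min_eq_left (by nlinarith)
    simp only [hm]
    exact (key y (by linarith)).symm

lemma norm_inv_smul_pos {r : ℝ} (hr : 0 < r) (z : 𝔼) : ‖r⁻¹ • z‖ = r⁻¹ * ‖z‖ := by
  rw [norm_smul, Real.norm_of_nonneg (by positivity)]

lemma levyKernel_inv_smul {r : ℝ} (hr : 0 < r) (σ : ℝ) (z : 𝔼) :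
    levyKernel σ (r⁻¹ • z) =
      r ^ ((N : ℝ) + σ) * (min 1 ((‖z‖ / r) ^ 2) / ‖z‖ ^ ((N : ℝ) + σ)) := by
  unfold levyKernel
  rw [norm_inv_smul_pos hr, Real.mul_rpow (by positivity) (norm_nonneg _),
    Real.inv_rpow hr.le, show r⁻¹ * ‖z‖ = ‖z‖ / r by ring]
  have : r ^ ((N : ℝ) + σ) ≠ 0 := (Real.rpow_pos_of_pos hr _).ne'
  rcases eq_or_ne (‖z‖ ^ ((N : ℝ) + σ)) 0 with h | h
  · simp [h]
  · field_simp

lemma integrable_levyKernel_scaled (hN : 1 ≤ N) {σ : ℝ} (hσ : 0 < σ) (hσ2 : σ < 2) {r : ℝ}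
    (hr : 0 < r) :
    Integrable (fun z : 𝔼 => min 1 ((‖z‖ / r) ^ 2) / ‖z‖ ^ ((N : ℝ) + σ)) := by
  have h := ((integrable_levyKernel hN hσ hσ2).comp_smul (inv_ne_zero hr.ne')).const_mul
    ((r ^ ((N : ℝ) + σ))⁻¹)
  refine h.congr (Eventually.of_forall fun z => ?_)
  have : r ^ ((N : ℝ) + σ) ≠ 0 := (Real.rpow_pos_of_pos hr _).ne'
  simp only [levyKernel_inv_smul hr]
  field_simp

lemma integral_levyKernel_scaled (σ : ℝ) {r : ℝ} (hr : 0 < r) :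
    ∫ z : 𝔼, min 1 ((‖z‖ / r) ^ 2) / ‖z‖ ^ ((N : ℝ) + σ) =
      r ^ (-σ) * ∫ z : 𝔼, levyKernel σ z := by
  have h := Measure.integral_comp_inv_smul_of_nonneg (volume : Measure 𝔼) (levyKernel σ) hr.le
  simp only [levyKernel_inv_smul hr, integral_const_mul, finrank_euclideanSpace,
    Fintype.card_fin, smul_eq_mul] at h
  have h0 : 0 < r ^ ((N : ℝ) + σ) := Real.rpow_pos_of_pos hr _
  have h1 : r ^ N = r ^ ((N : ℝ) + σ) * r ^ (-σ) := by
    rw [← Real.rpow_add hr, ← Real.rpow_natCast]; congr 1; ring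
  rw [h1, mul_assoc] at h
  exact mul_left_cancel₀ h0.ne' h

lemma bracketWeight_eq_scaled {R : ℝ} (hR : 0 < R) (a : ℝ) (x : 𝔼) :
    bracketWeight R a x = R ^ (-a) * bracketWeight 1 a (R⁻¹ • x) := by
  unfold bracketWeight
  rw [norm_inv_smul_pos hR]
  have h1 : R ^ 2 + ‖x‖ ^ 2 = R ^ 2 * (1 ^ 2 + (R⁻¹ * ‖x‖) ^ 2) := by field_simp
  rw [h1, Real.mul_rpow (by positivity) (by positivity), ← Real.rpow_natCast, ← Real.rpow_mul hR.le]
  congr 2; push_cast; ring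

lemma integrable_bracketWeight_one {a : ℝ} (ha : (N : ℝ) < a) :
    Integrable (bracketWeight (N := N) 1 a) := by
  have := integrable_rpow_neg_one_add_norm_sq (μ := (volume : Measure 𝔼)) (r := a) (by simpa using ha)
  refine this.congr (Eventually.of_forall fun x => ?_)
  simp [bracketWeight, neg_div]

lemma integrable_bracketWeight {R : ℝ} (hR : 0 < R) {a : ℝ} (ha : (N : ℝ) < a) :
    Integrable (bracketWeight (N := N) R a) := by
  have h := ((integrable_bracketWeight_one ha).comp_smul (inv_ne_zero hR.ne')).const_mul (R ^ (-a))
  exact h.congr (Eventually.of_forall fun x => (bracketWeight_eq_scaled hR a x).symm)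

lemma integral_bracketWeight {R : ℝ} (hR : 0 < R) (a : ℝ) :
    ∫ x : 𝔼, bracketWeight R a x = R ^ ((N : ℝ) - a) * ∫ x : 𝔼, bracketWeight 1 a x := by
  simp only [bracketWeight_eq_scaled hR, integral_const_mul]
  rw [Measure.integral_comp_inv_smul_of_nonneg (volume : Measure 𝔼) _ hR.le]
  rw [sub_eq_neg_add, Real.rpow_add hR, Real.rpow_natCast]
  simp [mul_assoc]

/-! ### Pointwise bounds for the singular integrand. -/

/-- Decay of a function and of its second differences, relative to `(R² + |x|²)^{-a/2}`. -/
structure BracketDecay (R a A : ℝ) (ψ : 𝔼 → ℝ) : Prop where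
  cont : Continuous ψ
  bound : ∀ x, |ψ x| ≤ A * bracketWeight R a x
  -- For such z the whole segment from x - z to x + z keeps R² + |·|² comparable to R² + |x|², so a
  -- Taylor estimate can be written with the weight at x alone.
  secondDiff_le : ∀ x z, ‖z‖ ^ 2 ≤ (R ^ 2 + ‖x‖ ^ 2) / 4 →
    |secondDiff ψ x z| ≤ A * bracketWeight R (a + 2) x * ‖z‖ ^ 2

/-- The integrable majorant of `z ↦ secondDiff ψ x z / |z|^{N+σ}`. -/
def majorant (σ R a : ℝ) (x z : 𝔼) : ℝ :=
  16 * bracketWeight R a x * (min 1 ((‖z‖ / √(R ^ 2 + ‖x‖ ^ 2)) ^ 2) / ‖z‖ ^ ((N : ℝ) + σ)) +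
    2 ^ ((N : ℝ) + σ) * bracketWeight R (N + σ) x *
      (bracketWeight R a (x + z) + bracketWeight R a (x - z))

lemma BracketDecay.nonneg {R a A : ℝ} (hR : 0 < R) {ψ : 𝔼 → ℝ} (h : BracketDecay R a A ψ) :
    0 ≤ A := by
  have := (abs_nonneg _).trans (h.bound 0)
  exact nonneg_of_mul_nonneg_left this (bracketWeight_pos hR a 0)

lemma integrable_majorant (hN : 1 ≤ N) {σ : ℝ} (hσ : 0 < σ) (hσ2 : σ < 2) {R a : ℝ} (hR : 0 < R)
    (ha : (N : ℝ) < a) (x : 𝔼) : Integrable (majorant σ R a x) := by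
  unfold majorant
  refine ((integrable_levyKernel_scaled hN hσ hσ2 (by positivity)).const_mul _).add
    (Integrable.const_mul (Integrable.add ?_ ?_) _)
  · exact (integrable_bracketWeight hR ha).comp_add_left x
  · exact (integrable_bracketWeight hR ha).comp_sub_left x

lemma bracketWeight_mul {R : ℝ} (hR : 0 < R) (a b : ℝ) (x : 𝔼) :
    bracketWeight R a x * bracketWeight R b x = bracketWeight R (a + b) x := by
  unfold bracketWeight
  rw [← Real.rpow_add (by positivity)]; congr 1; ring

lemma sqrt_rpow_neg {R : ℝ} (hR : 0 < R) (a : ℝ) (x : 𝔼) :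
    √(R ^ 2 + ‖x‖ ^ 2) ^ (-a) = bracketWeight R a x := by
  unfold bracketWeight
  rw [Real.sqrt_eq_rpow, ← Real.rpow_mul (by positivity)]; congr 1; ring

lemma bracketWeight_le_rpow {R b : ℝ} (hR : 0 < R) (hb : 0 ≤ b) (x : 𝔼) :
    bracketWeight R b x ≤ R ^ (-b) := by
  rw [← sqrt_rpow_neg hR]
  refine Real.rpow_le_rpow_of_nonpos hR ?_ (by linarith)
  exact Real.le_sqrt_of_sq_le (by nlinarith [sq_nonneg ‖x‖])

/-- Both terms scale like R^{N-a}. In the first, w_a w_σ = w_{a-N} w_{N+σ} and w_{a-N} ≤ R^{N-a}; in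
the second, R^{N-a} comes from the total mass of the weight. -/
lemma integral_majorant_le (hN : 1 ≤ N) {σ : ℝ} (hσ : 0 < σ) (hσ2 : σ < 2) {R a : ℝ} (hR : 0 < R)
    (ha : (N : ℝ) < a) (x : 𝔼) :
    ∫ z, majorant σ R a x z ≤
      (16 * (∫ z : 𝔼, levyKernel σ z) +
        2 ^ ((N : ℝ) + σ) * (2 * ∫ x : 𝔼, bracketWeight 1 a x)) * R ^ ((N : ℝ) - a) *
        bracketWeight R (N + σ) x := by
  have hI : Integrable fun z => bracketWeight R a (x + z) + bracketWeight R a (x - z) :=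
    ((integrable_bracketWeight hR ha).comp_add_left x).add
      ((integrable_bracketWeight hR ha).comp_sub_left x)
  unfold majorant
  rw [integral_add ((integrable_levyKernel_scaled hN hσ hσ2 (by positivity)).const_mul _)
    (hI.const_mul _), integral_const_mul,
    integral_const_mul, integral_add ((integrable_bracketWeight hR ha).comp_add_left x)
      ((integrable_bracketWeight hR ha).comp_sub_left x),
    integral_levyKernel_scaled _ (by positivity), integral_add_left_eq_self (bracketWeight R a),
    integral_sub_left_eq_self (bracketWeight R a), integral_bracketWeight hR, sqrt_rpow_neg hR]
  have hk : 0 ≤ ∫ z : 𝔼, levyKernel σ z := integral_nonneg fun z => levyKernel_nonneg σ z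
  have h1 : bracketWeight R a x * bracketWeight R σ x ≤
      R ^ ((N : ℝ) - a) * bracketWeight R (N + σ) x := by
    have e : bracketWeight R a x * bracketWeight R σ x =
      bracketWeight R (a - N) x * bracketWeight R (N + σ) x := by
      rw [bracketWeight_mul hR, bracketWeight_mul hR]; congr 1; ring
    rw [e]
    gcongr
    · exact (bracketWeight_pos hR _ x).le
    · have := bracketWeight_le_rpow hR (b := a - N) (by linarith) x
      simpa using this
  have h2 := mul_le_mul_of_nonneg_left h1 (mul_nonneg (by norm_num : (0 : ℝ) ≤ 16) hk)
  nlinarith [h2]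

/-- Split at |z| = r/2 with r² = R² + |x|². Near the origin the second-difference bound applies. Far
away |z|^{-N-σ} is at most 2^{N+σ} r^{-N-σ}, and the translates of the weight remain integrable in
z. -/
lemma BracketDecay.secondDiff_div_le {σ : ℝ} (hσ : 0 < σ) {R a A : ℝ} (hR : 0 < R)
    {ψ : 𝔼 → ℝ} (h : BracketDecay R a A ψ) (x z : 𝔼) :
    |secondDiff ψ x z / ‖z‖ ^ ((N : ℝ) + σ)| ≤ A * majorant σ R a x z := by
  have hA := h.nonneg hR
  have hw := bracketWeight_pos hR a x
  have hw' := bracketWeight_pos hR ((N : ℝ) + σ) x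
  have hp := bracketWeight_pos hR a (x + z)
  have hm := bracketWeight_pos hR a (x - z)
  set r := √(R ^ 2 + ‖x‖ ^ 2) with hr
  have hr0 : 0 < r := by positivity
  have hr2 : r ^ 2 = R ^ 2 + ‖x‖ ^ 2 := Real.sq_sqrt (by positivity)
  have hD : 0 ≤ ‖z‖ ^ ((N : ℝ) + σ) := by positivity
  rw [abs_div, abs_of_nonneg hD]
  have hmin : 0 ≤ min 1 ((‖z‖ / r) ^ 2) / ‖z‖ ^ ((N : ℝ) + σ) := by positivity
  by_cases hz : ‖z‖ ^ 2 ≤ (R ^ 2 + ‖x‖ ^ 2) / 4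
  · have h1 := h.secondDiff_le x z hz
    have hq : (‖z‖ / r) ^ 2 ≤ 1 := by
      rw [div_pow, hr2]; exact div_le_one_of_le₀ (by linarith [hr2, sq_nonneg r]) (by positivity)
    have h2 : bracketWeight R (a + 2) x * ‖z‖ ^ 2 = bracketWeight R a x * (‖z‖ / r) ^ 2 := by
      rw [← bracketWeight_mul hR, ← sqrt_rpow_neg hR 2, ← hr, Real.rpow_neg hr0.le,
        div_pow]
      norm_cast
      field_simp
    have h3 : |secondDiff ψ x z| ≤ A * (16 * bracketWeight R a x * min 1 ((‖z‖ / r) ^ 2)) := by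
      rw [min_eq_right hq]
      calc _ ≤ A * (bracketWeight R (a + 2) x * ‖z‖ ^ 2) := by linarith
        _ ≤ _ := by
          rw [h2]; gcongr ?_ * ?_
          nlinarith [mul_nonneg hw.le (sq_nonneg (‖z‖ / r))]
    calc _ ≤ A * (16 * bracketWeight R a x * min 1 ((‖z‖ / r) ^ 2)) / ‖z‖ ^ ((N : ℝ) + σ) := by
          gcongr
      _ = A * (16 * bracketWeight R a x * (min 1 ((‖z‖ / r) ^ 2) / ‖z‖ ^ ((N : ℝ) + σ))) := by ring
      _ ≤ _ := by
        unfold majorant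
        gcongr
        have : 0 ≤ (2 : ℝ) ^ ((N : ℝ) + σ) * bracketWeight R (N + σ) x *
          (bracketWeight R a (x + z) + bracketWeight R a (x - z)) := by positivity
        linarith
  · push Not at hz
    have hzr : r / 2 < ‖z‖ := by
      refine lt_of_pow_lt_pow_left₀ 2 (norm_nonneg _) ?_
      rw [div_pow, hr2]; linarith
    have hz0 : 0 < ‖z‖ := by linarith
    have hq : 1 / 4 ≤ min 1 ((‖z‖ / r) ^ 2) := by
      refine le_min (by norm_num) ?_
      rw [div_pow, le_div_iff₀ (by positivity), hr2]; linarith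
    have hs : |secondDiff ψ x z| ≤ A * (2 * bracketWeight R a x +
        bracketWeight R a (x + z) + bracketWeight R a (x - z)) := by
      unfold secondDiff
      have e1 := abs_le.1 (h.bound x)
      have e2 := abs_le.1 (h.bound (x + z))
      have e3 := abs_le.1 (h.bound (x - z))
      rw [abs_le]; constructor <;> nlinarith
    have hi : 1 / ‖z‖ ^ ((N : ℝ) + σ) ≤ 2 ^ ((N : ℝ) + σ) * bracketWeight R (N + σ) x := by
      rw [← sqrt_rpow_neg hR, ← hr, Real.rpow_neg hr0.le, ← div_eq_mul_inv,
        div_le_div_iff₀ (by positivity) (by positivity), one_mul,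
        ← Real.mul_rpow (by norm_num) hz0.le]
      exact Real.rpow_le_rpow hr0.le (by linarith) (by positivity)
    -- The term 2ψ(x) must go into the Lévy part of the majorant, whose numerator is at least 1/4
    -- here; hence the coefficient 8, which 16 dominates.
    have hmin' : 1 / ‖z‖ ^ ((N : ℝ) + σ) * (1 / 4) ≤
        min 1 ((‖z‖ / r) ^ 2) / ‖z‖ ^ ((N : ℝ) + σ) := by
      rw [div_mul_eq_mul_div, one_mul]; gcongr
    calc _ ≤ A * (2 * bracketWeight R a x +
        bracketWeight R a (x + z) + bracketWeight R a (x - z)) / ‖z‖ ^ ((N : ℝ) + σ) := by gcongr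
      _ = A * (8 * bracketWeight R a x * (1 / ‖z‖ ^ ((N : ℝ) + σ) * (1 / 4)) +
          1 / ‖z‖ ^ ((N : ℝ) + σ) * (bracketWeight R a (x + z) + bracketWeight R a (x - z))) := by
        ring
      _ ≤ A * (16 * bracketWeight R a x * (min 1 ((‖z‖ / r) ^ 2) / ‖z‖ ^ ((N : ℝ) + σ)) +
          2 ^ ((N : ℝ) + σ) * bracketWeight R (N + σ) x *
          (bracketWeight R a (x + z) + bracketWeight R a (x - z))) := by
        gcongr
        norm_num
      _ = _ := rfl

/-! ### The principal value: symmetrisation, existence and decay. -/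

section

lemma integrableOn_kernel (hN : 1 ≤ N) {σ : ℝ} (hσ : 0 < σ) (hσ2 : σ < 2) {ε : ℝ} (hε : 0 < ε) :
    IntegrableOn (fun z : 𝔼 => 1 / ‖z‖ ^ ((N : ℝ) + σ)) {z | ε < ‖z‖} := by
  have hS : MeasurableSet {z : 𝔼 | ε < ‖z‖} := measurableSet_lt measurable_const measurable_norm
  have h := ((integrable_levyKernel (N := N) hN hσ hσ2).integrableOn
    (s := {z | ε < ‖z‖})).const_mul (min 1 (ε ^ 2))⁻¹
  refine Integrable.mono' h (Measurable.aestronglyMeasurable (by fun_prop)) ?_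
  refine (ae_restrict_iff' hS).2 (Eventually.of_forall fun z hz => ?_)
  have hm : 0 < min 1 (ε ^ 2) := lt_min one_pos (by positivity)
  have hz' : ε < ‖z‖ := hz
  have hmz : min 1 (ε ^ 2) ≤ min 1 (‖z‖ ^ 2) := by gcongr
  rw [Real.norm_of_nonneg (by positivity), levyKernel, ← mul_div_assoc]
  gcongr
  rw [inv_mul_eq_div, le_div_iff₀ hm]; linarith

/-- Symmetrisation of the truncated singular integral. -/
lemma truncated_integral_eq (hN : 1 ≤ N) {σ : ℝ} (hσ : 0 < σ) (hσ2 : σ < 2) {ψ : 𝔼 → ℝ}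
    (hc : Continuous ψ) {M : ℝ} (hM : ∀ x, |ψ x| ≤ M) (x : 𝔼) {ε : ℝ} (hε : 0 < ε) :
    ∫ y in {y : 𝔼 | ε < ‖x - y‖}, (ψ x - ψ y) / ‖x - y‖ ^ ((N : ℝ) + σ) =
      1 / 2 * ∫ z, {z : 𝔼 | ε < ‖z‖}.indicator
        (fun z => secondDiff ψ x z / ‖z‖ ^ ((N : ℝ) + σ)) z := by
  have hS : MeasurableSet {z : 𝔼 | ε < ‖z‖} := measurableSet_lt measurable_const measurable_norm
  have hS' : MeasurableSet {y : 𝔼 | ε < ‖x - y‖} :=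
    measurableSet_lt measurable_const (by fun_prop)
  set F : 𝔼 → ℝ := {y : 𝔼 | ε < ‖x - y‖}.indicator
    (fun y => (ψ x - ψ y) / ‖x - y‖ ^ ((N : ℝ) + σ)) with hF
  have hFp : ∀ z, F (x + z) = {z : 𝔼 | ε < ‖z‖}.indicator
      (fun z => (ψ x - ψ (x + z)) / ‖z‖ ^ ((N : ℝ) + σ)) z := by
    intro z; simp [hF, indicator]
  have hFm : ∀ z, F (x - z) = {z : 𝔼 | ε < ‖z‖}.indicator
      (fun z => (ψ x - ψ (x - z)) / ‖z‖ ^ ((N : ℝ) + σ)) z := by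
    intro z; simp [hF, indicator]
  have hint : Integrable (fun z => F (x + z)) := by
    simp only [hFp]
    rw [integrable_indicator_iff hS]
    refine Integrable.mono' ((integrableOn_kernel hN hσ hσ2 hε).const_mul (2 * M))
      (Measurable.aestronglyMeasurable (by fun_prop)) (Eventually.of_forall fun z => ?_)
    rw [Real.norm_eq_abs, abs_div, abs_of_nonneg (a := ‖z‖ ^ ((N : ℝ) + σ)) (by positivity),
      mul_one_div]
    gcongr
    have e1 := abs_le.1 (hM x)
    have e2 := abs_le.1 (hM (x + z))
    rw [abs_le]; constructor <;> linarith
  have hintm : Integrable (fun z => F (x - z)) := by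
    have := hint.comp_neg
    simpa [sub_eq_add_neg] using this
  have h1 : ∫ y in {y : 𝔼 | ε < ‖x - y‖}, (ψ x - ψ y) / ‖x - y‖ ^ ((N : ℝ) + σ) = ∫ y, F y :=
    (integral_indicator hS').symm
  have h2 : ∫ z, F (x + z) = ∫ y, F y := integral_add_left_eq_self F x
  have h3 : ∫ z, F (x - z) = ∫ y, F y := integral_sub_left_eq_self F volume x
  have h4 : ∫ z, (F (x + z) + F (x - z)) = ∫ z, {z : 𝔼 | ε < ‖z‖}.indicator
        (fun z => secondDiff ψ x z / ‖z‖ ^ ((N : ℝ) + σ)) z := by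
    congr 1; ext z
    rw [hFp, hFm]
    by_cases hz : z ∈ {z : 𝔼 | ε < ‖z‖}
    · simp only [indicator_of_mem hz, secondDiff]; ring
    · simp only [indicator_of_notMem hz]; ring
  rw [h1, ← h4, integral_add hint hintm, h2, h3]; ring

variable {σ R a A : ℝ} {ψ : EuclideanSpace ℝ (Fin N) → ℝ}

lemma BracketDecay.integrable_secondDiff_div (hN : 1 ≤ N) (hσ : 0 < σ) (hσ2 : σ < 2) (hR : 0 < R)
    (ha : (N : ℝ) < a) (h : BracketDecay R a A ψ) (x : 𝔼) :
    Integrable (fun z => secondDiff ψ x z / ‖z‖ ^ ((N : ℝ) + σ)) := by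
  have := h.cont
  refine Integrable.mono' ((integrable_majorant hN hσ hσ2 hR ha x).const_mul A)
    (Measurable.aestronglyMeasurable (by unfold secondDiff; fun_prop)) (Eventually.of_forall ?_)
  exact h.secondDiff_div_le hσ hR x

lemma BracketDecay.tendsto_truncated (hN : 1 ≤ N) (hσ : 0 < σ) (hσ2 : σ < 2) (hR : 0 < R)
    (ha : (N : ℝ) < a) (h : BracketDecay R a A ψ) (x : 𝔼) :
    Tendsto (fun ε : ℝ => ∫ y in {y : 𝔼 | ε < ‖x - y‖}, (ψ x - ψ y) / ‖x - y‖ ^ ((N : ℝ) + σ))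
      (𝓝[>] 0) (𝓝 (1 / 2 * ∫ z, secondDiff ψ x z / ‖z‖ ^ ((N : ℝ) + σ))) := by
  have hA := h.nonneg hR
  have hcont := h.cont
  have hM : ∀ y, |ψ y| ≤ A * R ^ (-a) := fun y => (h.bound y).trans (by
    gcongr; exact bracketWeight_le_rpow hR (by linarith [(Nat.cast_nonneg N : (0 : ℝ) ≤ N)]) y)
  have key : Tendsto (fun ε : ℝ => 1 / 2 * ∫ z, {z : 𝔼 | ε < ‖z‖}.indicator
        (fun z => secondDiff ψ x z / ‖z‖ ^ ((N : ℝ) + σ)) z) (𝓝[>] 0)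
      (𝓝 (1 / 2 * ∫ z, secondDiff ψ x z / ‖z‖ ^ ((N : ℝ) + σ))) := by
    refine Tendsto.const_mul _ ?_
    have hi := h.integrable_secondDiff_div hN hσ hσ2 hR ha x
    refine tendsto_integral_filter_of_dominated_convergence
      (fun z => ‖secondDiff ψ x z / ‖z‖ ^ ((N : ℝ) + σ)‖) ?_ ?_ hi.norm ?_
    · refine Eventually.of_forall fun ε => hi.aestronglyMeasurable.indicator ?_
      exact measurableSet_lt measurable_const measurable_norm
    · exact Eventually.of_forall fun ε => Eventually.of_forall fun z =>
        norm_indicator_le_norm_self _ _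
    · refine Eventually.of_forall fun z => ?_
      rcases eq_or_ne z 0 with rfl | hz
      · refine tendsto_const_nhds.congr' (Eventually.of_forall fun ε => ?_)
        simp [secondDiff, indicator]
        intro _; left; ring
      · refine tendsto_const_nhds.congr' ?_
        have : ∀ᶠ ε : ℝ in 𝓝[>] 0, ε < ‖z‖ :=
          (eventually_lt_nhds (norm_pos_iff.2 hz)).filter_mono nhdsWithin_le_nhds
        filter_upwards [this] with ε hε
        rw [indicator_of_mem (show z ∈ {z : 𝔼 | ε < ‖z‖} from hε)]
  refine key.congr' ?_
  filter_upwards [self_mem_nhdsWithin] with ε hε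
  exact (truncated_integral_eq hN hσ hσ2 h.cont hM x hε).symm

lemma BracketDecay.fracLaplacian_eq (hN : 1 ≤ N) (hσ : 0 < σ) (hσ2 : σ < 2) (hR : 0 < R)
    (ha : (N : ℝ) < a) (h : BracketDecay R a A ψ) (x : 𝔼) :
    fracLaplacian σ ψ x =
      fracLapConst N σ * (1 / 2 * ∫ z, secondDiff ψ x z / ‖z‖ ^ ((N : ℝ) + σ)) := by
  unfold fracLaplacian
  rw [(h.tendsto_truncated hN hσ hσ2 hR ha x).limUnder_eq]

/-- Homogeneity has to be derived from convergence of the truncated integrals, since `limUnder` is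
meaningful only when the limit exists. -/
lemma BracketDecay.fracLaplacian_const_mul (hN : 1 ≤ N) (hσ : 0 < σ) (hσ2 : σ < 2) (hR : 0 < R)
    (ha : (N : ℝ) < a) (h : BracketDecay R a A ψ) (c : ℝ) (x : 𝔼) :
    fracLaplacian σ (fun y => c * ψ y) x = c * fracLaplacian σ ψ x := by
  rw [h.fracLaplacian_eq hN hσ hσ2 hR ha, fracLaplacian]
  have := (h.tendsto_truncated hN hσ hσ2 hR ha x).const_mul c
  have e : ∀ ε : ℝ, c * ∫ y in {y : 𝔼 | ε < ‖x - y‖}, (ψ x - ψ y) / ‖x - y‖ ^ ((N : ℝ) + σ) =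
      ∫ y in {y : 𝔼 | ε < ‖x - y‖}, (c * ψ x - c * ψ y) / ‖x - y‖ ^ ((N : ℝ) + σ) := by
    intro ε
    rw [← integral_const_mul]
    congr 1; ext y; ring
  simp only [e] at this
  rw [this.limUnder_eq]; ring

lemma BracketDecay.measurable_fracLaplacian (hN : 1 ≤ N) (hσ : 0 < σ) (hσ2 : σ < 2) (hR : 0 < R)
    (ha : (N : ℝ) < a) (h : BracketDecay R a A ψ) : Measurable (fracLaplacian σ ψ) := by
  have : fracLaplacian σ ψ = fun x => fracLapConst N σ *
      (1 / 2 * ∫ z, secondDiff ψ x z / ‖z‖ ^ ((N : ℝ) + σ)) :=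
    funext fun x => h.fracLaplacian_eq hN hσ hσ2 hR ha x
  rw [this]
  have hcont := h.cont
  have hm : StronglyMeasurable (fun p : 𝔼 × 𝔼 => secondDiff ψ p.1 p.2 / ‖p.2‖ ^ ((N : ℝ) + σ)) := by
    refine Measurable.stronglyMeasurable ?_
    unfold secondDiff; fun_prop
  exact (hm.integral_prod_right'.measurable.const_mul _).const_mul _

/-- The constant in the decay estimate of the fractional Laplacian. -/
def fracLapBound (N : ℕ) (σ a : ℝ) : ℝ :=
  |fracLapConst N σ| * (1 / 2 * (16 * (∫ z : EuclideanSpace ℝ (Fin N), levyKernel σ z) +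
        2 ^ ((N : ℝ) + σ) * (2 * ∫ x : EuclideanSpace ℝ (Fin N), bracketWeight 1 a x)))

lemma fracLapBound_nonneg (N : ℕ) (σ a : ℝ) : 0 ≤ fracLapBound N σ a := by
  have h1 : 0 ≤ ∫ z : EuclideanSpace ℝ (Fin N), levyKernel σ z :=
    integral_nonneg fun z => levyKernel_nonneg σ z
  have h2 : 0 ≤ ∫ x : EuclideanSpace ℝ (Fin N), bracketWeight 1 a x :=
    integral_nonneg fun z => (bracketWeight_pos one_pos a z).le
  unfold fracLapBound
  positivity

lemma BracketDecay.abs_fracLaplacian_le (hN : 1 ≤ N) (hσ : 0 < σ) (hσ2 : σ < 2) (hR : 0 < R)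
    (ha : (N : ℝ) < a) (h : BracketDecay R a A ψ) (x : 𝔼) :
    |fracLaplacian σ ψ x| ≤
      fracLapBound N σ a * A * R ^ ((N : ℝ) - a) * bracketWeight R (N + σ) x := by
  have hA := h.nonneg hR
  have h1 : |∫ z, secondDiff ψ x z / ‖z‖ ^ ((N : ℝ) + σ)| ≤ A * ∫ z, majorant σ R a x z := by
    rw [← integral_const_mul]
    rw [← Real.norm_eq_abs]
    exact norm_integral_le_of_norm_le ((integrable_majorant hN hσ hσ2 hR ha x).const_mul A)
      (Eventually.of_forall fun z => h.secondDiff_div_le hσ hR x z)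
  have h2 := integral_majorant_le hN hσ hσ2 hR ha x
  rw [h.fracLaplacian_eq hN hσ hσ2 hR ha, abs_mul, abs_mul, abs_of_pos (by norm_num : (0 : ℝ) < 1 / 2)]
  calc _ ≤ |fracLapConst N σ| * (1 / 2 * (A * ((16 * (∫ z : 𝔼, levyKernel σ z) +
          2 ^ ((N : ℝ) + σ) * (2 * ∫ x : 𝔼, bracketWeight 1 a x)) * R ^ ((N : ℝ) - a) *
          bracketWeight R (N + σ) x))) := by
        gcongr; exact h1.trans (mul_le_mul_of_nonneg_left h2 hA)
    _ = _ := by unfold fracLapBound; ring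

/-- The weight is relaxed to ρ, which does not depend on R, but the factor R^{N-a} is kept: it is
the source of tightness. -/
lemma BracketDecay.abs_fracLaplacian_le_rho (hN : 1 ≤ N) (hσ : 0 < σ) (hσ2 : σ < 2) (hR : 1 ≤ R)
    (ha : (N : ℝ) < a) (h : BracketDecay R a A ψ) (x : 𝔼) :
    |fracLaplacian σ ψ x| ≤ fracLapBound N σ a * A * R ^ ((N : ℝ) - a) * rhoWeight σ x := by
  have hR0 : 0 < R := by linarith
  refine (h.abs_fracLaplacian_le hN hσ hσ2 hR0 ha x).trans ?_
  have := h.nonneg hR0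
  have := fracLapBound_nonneg N σ a
  refine mul_le_mul_of_nonneg_left ?_ (by positivity)
  unfold bracketWeight rhoWeight
  refine Real.rpow_le_rpow_of_nonpos (by positivity) (by nlinarith) ?_
  have : 0 ≤ ((N : ℝ) + σ) / 2 := by positivity
  linarith

end

/-! ### Truncated weights with estimates uniform in the truncation. -/

/-- Mean value inequality twice: h(t) + h(-t) has derivative h₁(t) - h₁(-t), which is at most 2Bt ≤
2B on [0, 1]. -/
lemma abs_two_mul_sub_sub_le {h h₁ h₂ : ℝ → ℝ} {B : ℝ}
    (hh : ∀ t ∈ Icc (-1 : ℝ) 1, HasDerivAt h (h₁ t) t)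
    (hh₁ : ∀ t ∈ Icc (-1 : ℝ) 1, HasDerivAt h₁ (h₂ t) t)
    (hB : ∀ t ∈ Icc (-1 : ℝ) 1, |h₂ t| ≤ B) :
    |2 * h 0 - h 1 - h (-1)| ≤ 2 * B := by
  have hB0 : 0 ≤ B := (abs_nonneg _).trans (hB 0 (by norm_num))
  have h1 : ∀ t ∈ Icc (0 : ℝ) 1, |h₁ t - h₁ (-t)| ≤ 2 * B := by
    intro t ht
    have := (convex_Icc (-1 : ℝ) 1).norm_image_sub_le_of_norm_hasDerivWithin_le
      (fun s hs => (hh₁ s hs).hasDerivWithinAt) hB (x := -t) (y := t)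
      ⟨by linarith [ht.2], by linarith [ht.1]⟩ ⟨by linarith [ht.1], ht.2⟩
    rw [Real.norm_eq_abs, Real.norm_eq_abs, abs_of_nonneg (by linarith [ht.1] : 0 ≤ t - -t)] at this
    exact this.trans (by nlinarith [ht.2])
  have hd : ∀ t ∈ Icc (0 : ℝ) 1,
      HasDerivWithinAt (fun s => h s + h (-s)) (h₁ t - h₁ (-t)) (Icc 0 1) t := by
    intro t ht
    have e1 := hh t ⟨by linarith [ht.1], ht.2⟩
    have e2 := (hh (-t) ⟨by linarith [ht.2], by linarith [ht.1]⟩).comp t (hasDerivAt_neg t)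
    exact (e1.add e2).hasDerivWithinAt.congr_deriv (by ring)
  have := (convex_Icc (0 : ℝ) 1).norm_image_sub_le_of_norm_hasDerivWithin_le hd h1
    (x := 0) (y := 1) (by norm_num) (by norm_num)
  rw [Real.norm_eq_abs, abs_sub_comm] at this
  simp only [neg_zero, sub_zero, norm_one, mul_one] at this
  convert this using 2
  ring

/-- A smooth cutoff, equal to `1` on `(-∞, 1]` and to `0` on `[2, ∞)`. -/
def cutoff (y : ℝ) : ℝ := Real.smoothTransition (2 - y)

lemma contDiff_cutoff {n : ℕ∞} : ContDiff ℝ n cutoff :=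
  Real.smoothTransition.contDiff.comp (contDiff_const.sub contDiff_id)

lemma cutoff_nonneg (y : ℝ) : 0 ≤ cutoff y := Real.smoothTransition.nonneg _

lemma cutoff_le_one (y : ℝ) : cutoff y ≤ 1 := Real.smoothTransition.le_one _

lemma cutoff_eq_one {y : ℝ} (hy : y ≤ 1) : cutoff y = 1 :=
  Real.smoothTransition.one_of_one_le (by linarith)

lemma cutoff_eq_zero {y : ℝ} (hy : 2 ≤ y) : cutoff y = 0 :=
  Real.smoothTransition.zero_of_nonpos (by linarith)

lemma hasCompactSupport_deriv_cutoff : HasCompactSupport (deriv cutoff) := by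
  refine HasCompactSupport.intro (isCompact_Icc (a := (1 : ℝ)) (b := 2)) fun y hy => ?_
  rw [mem_Icc, not_and_or, not_le, not_le] at hy
  rcases hy with hy | hy
  · have : cutoff =ᶠ[𝓝 y] fun _ => 1 := by
      filter_upwards [eventually_lt_nhds hy] with s hs using cutoff_eq_one hs.le
    rw [this.deriv_eq, deriv_const]
  · have : cutoff =ᶠ[𝓝 y] fun _ => 0 := by
      filter_upwards [eventually_gt_nhds hy] with s hs using cutoff_eq_zero hs.le
    rw [this.deriv_eq, deriv_const]

lemma contDiff_deriv_cutoff : ContDiff ℝ 1 (deriv cutoff) :=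
  (contDiff_succ_iff_deriv.1 (contDiff_cutoff (n := 2))).2.2

/-- These are the scale-invariant quantities: at y = τ/k they bound the τ-derivatives of χ(τ/k) by
powers of 1/τ, without k. -/
lemma exists_bound_deriv_cutoff :
    ∃ C, 0 ≤ C ∧ (∀ y, |y * deriv cutoff y| ≤ C) ∧ ∀ y, |y ^ 2 * deriv (deriv cutoff) y| ≤ C := by
  have c1 : Continuous (deriv cutoff) := contDiff_deriv_cutoff.continuous
  have c2 : Continuous (deriv (deriv cutoff)) := contDiff_deriv_cutoff.continuous_deriv le_rfl
  obtain ⟨C₁, h₁⟩ := (hasCompactSupport_deriv_cutoff.mul_left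
    (f := fun y : ℝ => y)).exists_bound_of_continuous (by exact continuous_id.mul c1)
  obtain ⟨C₂, h₂⟩ := (hasCompactSupport_deriv_cutoff.deriv.mul_left
    (f := fun y : ℝ => y ^ 2)).exists_bound_of_continuous (by exact (continuous_pow 2).mul c2)
  refine ⟨max C₁ C₂, ((norm_nonneg _).trans (h₁ 0)).trans (le_max_left _ _), fun y => ?_, fun y => ?_⟩
  · exact (h₁ y).trans (le_max_left _ _)
  · exact (h₂ y).trans (le_max_right _ _)

/-- The truncated power `τ^{-b} χ(τ/k)`. -/
def cutPower (b k τ : ℝ) : ℝ := τ ^ (-b) * cutoff (τ / k)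

lemma exists_cutPower_deriv (b : ℝ) (hb : 0 ≤ b) : ∃ C, 0 ≤ C ∧ ∀ k, 0 < k → ∃ d₁ d₂ : ℝ → ℝ,
    ∀ τ, 0 < τ → HasDerivAt (cutPower b k) (d₁ τ) τ ∧ HasDerivAt d₁ (d₂ τ) τ ∧
      |d₁ τ| ≤ C * τ ^ (-b - 1) ∧ |d₂ τ| ≤ C * τ ^ (-b - 1 - 1) := by
  obtain ⟨C, hC, h1, h2⟩ := exists_bound_deriv_cutoff
  refine ⟨b * (b + 1) + b + 2 * b * C + C, by positivity, fun k hk => ?_⟩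
  have dχ : ∀ τ, HasDerivAt (fun τ => cutoff (τ / k)) (deriv cutoff (τ / k) * (1 / k)) τ := by
    intro τ
    exact HasDerivAt.comp (h₂ := cutoff) (h := fun τ => τ / k) τ
      ((contDiff_cutoff (n := 1)).differentiable one_ne_zero (τ / k)).hasDerivAt
      ((hasDerivAt_id τ).div_const k)
  have dχ1 : ∀ τ, HasDerivAt (fun τ => deriv cutoff (τ / k))
      (deriv (deriv cutoff) (τ / k) * (1 / k)) τ := by
    intro τ
    exact (contDiff_deriv_cutoff.differentiable one_ne_zero (τ / k)).hasDerivAt.comp τ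
      ((hasDerivAt_id τ).div_const k)
  refine ⟨fun τ => -b * τ ^ (-b - 1) * cutoff (τ / k) +
      τ ^ (-b) * (deriv cutoff (τ / k) * (1 / k)),
    fun τ => (-b * ((-b - 1) * τ ^ (-b - 1 - 1)) * cutoff (τ / k) +
      -b * τ ^ (-b - 1) * (deriv cutoff (τ / k) * (1 / k))) +
      (-b * τ ^ (-b - 1) * (deriv cutoff (τ / k) * (1 / k)) +
        τ ^ (-b) * (deriv (deriv cutoff) (τ / k) * (1 / k) * (1 / k))), fun τ hτ => ?_⟩
  have p0 := Real.hasDerivAt_rpow_const (p := -b) (Or.inl hτ.ne')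
  have p1 := Real.hasDerivAt_rpow_const (p := -b - 1) (Or.inl hτ.ne')
  have e1 : τ ^ (-b) = τ ^ (-b - 1) * τ := by
    rw [← Real.rpow_add_one hτ.ne']; congr 1; ring
  have e2 : τ ^ (-b - 1) = τ ^ (-b - 1 - 1) * τ := by
    rw [← Real.rpow_add_one hτ.ne']; congr 1; ring
  have q1 : 0 < τ ^ (-b - 1) := Real.rpow_pos_of_pos hτ _
  have q2 : 0 < τ ^ (-b - 1 - 1) := Real.rpow_pos_of_pos hτ _
  have b0 : |cutoff (τ / k)| ≤ 1 := by
    rw [abs_of_nonneg (cutoff_nonneg _)]; exact cutoff_le_one _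
  have b1 := h1 (τ / k)
  have b2 := h2 (τ / k)
  refine ⟨p0.mul (dχ τ), ((p1.const_mul (-b)).mul (dχ τ)).add (p0.mul ((dχ1 τ).mul_const _)), ?_, ?_⟩
  · have : -b * τ ^ (-b - 1) * cutoff (τ / k) + τ ^ (-b) * (deriv cutoff (τ / k) * (1 / k)) =
        (-b * cutoff (τ / k) + τ / k * deriv cutoff (τ / k)) * τ ^ (-b - 1) := by rw [e1]; ring
    simp only [this]
    rw [abs_mul, abs_of_pos q1]
    gcongr
    refine (abs_add_le _ _).trans ?_
    rw [abs_mul, abs_neg, abs_of_nonneg hb]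
    nlinarith [mul_nonneg hb hb, mul_nonneg hb hC]
  · have : (-b * ((-b - 1) * τ ^ (-b - 1 - 1)) * cutoff (τ / k) +
      -b * τ ^ (-b - 1) * (deriv cutoff (τ / k) * (1 / k))) +
      (-b * τ ^ (-b - 1) * (deriv cutoff (τ / k) * (1 / k)) +
        τ ^ (-b) * (deriv (deriv cutoff) (τ / k) * (1 / k) * (1 / k))) =
        (b * (b + 1) * cutoff (τ / k) + -(2 * b) * (τ / k * deriv cutoff (τ / k)) +
          (τ / k) ^ 2 * deriv (deriv cutoff) (τ / k)) * τ ^ (-b - 1 - 1) := by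
      rw [e1, e2]; ring
    simp only [this]
    rw [abs_mul, abs_of_pos q2]
    gcongr
    refine (abs_add_three _ _ _).trans ?_
    rw [abs_mul, abs_mul (-(2 * b)), abs_neg, abs_of_nonneg (by positivity : 0 ≤ b * (b + 1)),
      abs_of_nonneg (by positivity : 0 ≤ 2 * b)]
    have := mul_le_mul_of_nonneg_left b0 (by positivity : 0 ≤ b * (b + 1))
    have := mul_le_mul_of_nonneg_left b1 (by positivity : 0 ≤ 2 * b)
    linarith

/-- The compactly supported weight `(R² + |x|²)^{-a/2} χ((R² + |x|²)/k)`. -/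
def cutWeight (R a k : ℝ) (x : 𝔼) : ℝ := cutPower (a / 2) k (R ^ 2 + ‖x‖ ^ 2)

lemma cutWeight_eq (R a k : ℝ) (x : 𝔼) :
    cutWeight R a k x = bracketWeight R a x * cutoff ((R ^ 2 + ‖x‖ ^ 2) / k) := rfl

lemma cutWeight_nonneg {R : ℝ} (hR : 0 < R) (a k : ℝ) (x : 𝔼) : 0 ≤ cutWeight R a k x :=
  mul_nonneg (bracketWeight_pos hR a x).le (cutoff_nonneg _)

lemma cutWeight_le {R : ℝ} (hR : 0 < R) (a k : ℝ) (x : 𝔼) :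
    cutWeight R a k x ≤ bracketWeight R a x :=
  mul_le_of_le_one_right (bracketWeight_pos hR a x).le (cutoff_le_one _)

lemma contDiff_cutWeight {R : ℝ} (hR : 0 < R) (a k : ℝ) :
    ContDiff ℝ ∞ (cutWeight (N := N) R a k) := by
  unfold cutWeight cutPower
  have hq : ContDiff ℝ ∞ fun x : 𝔼 => R ^ 2 + ‖x‖ ^ 2 :=
    contDiff_const.add (contDiff_norm_sq ℝ)
  refine ContDiff.mul (hq.rpow_const_of_ne fun x => ?_) (contDiff_cutoff.comp (hq.div_const k))
  positivity

lemma hasCompactSupport_cutWeight (R a : ℝ) {k : ℝ} (hk : 0 < k) :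
    HasCompactSupport (cutWeight (N := N) R a k) := by
  refine HasCompactSupport.intro (isCompact_closedBall (0 : 𝔼) √(2 * k)) fun x hx => ?_
  rw [mem_closedBall_zero_iff, not_le] at hx
  rw [cutWeight_eq, cutoff_eq_zero, mul_zero]
  rw [le_div_iff₀ hk]
  have := Real.lt_sq_of_sqrt_lt hx
  nlinarith [sq_nonneg R]

/-- On the line x + tz the weight is `cutPower` composed with a quadratic q(t), so the second
difference is controlled by two derivatives in t. The constant A depends on neither R nor k, which
permits k → ∞ and then R → ∞. -/
lemma exists_bracketDecay_cutWeight (N : ℕ) {a : ℝ} (ha : 0 ≤ a) :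
    ∃ A, ∀ R, 0 < R → ∀ k, 0 < k → BracketDecay (N := N) R a A (cutWeight R a k) := by
  obtain ⟨C, hC, hd⟩ := exists_cutPower_deriv (a / 2) (by positivity)
  refine ⟨max 1 (12 * C * 4 ^ (a / 2 + 1)), fun R hR k hk => ?_⟩
  obtain ⟨d₁, d₂, hd⟩ := hd k hk
  refine ⟨(contDiff_cutWeight hR a k).continuous, fun x => ?_, fun x z hz => ?_⟩
  · rw [abs_of_nonneg (cutWeight_nonneg hR a k x)]
    have := bracketWeight_pos hR a x
    have h1 := le_max_left 1 (12 * C * 4 ^ (a / 2 + 1))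
    have := cutWeight_le hR a k x
    nlinarith
  · set s := inner ℝ x z
    set n := ‖z‖ ^ 2 with hn
    have hn0 : 0 ≤ n := by positivity
    have hcs : s ^ 2 ≤ ‖x‖ ^ 2 * n := by
      rw [hn, ← mul_pow]; exact sq_le_sq' (by linarith [neg_le_of_abs_le (abs_real_inner_le_norm x z)])
        (real_inner_le_norm x z)
    set q : ℝ → ℝ := fun t => R ^ 2 + ‖x‖ ^ 2 + 2 * t * s + t ^ 2 * n with hq
    have hqn : ∀ t : ℝ, R ^ 2 + ‖x + t • z‖ ^ 2 = q t := by
      intro t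
      rw [norm_add_sq_real, inner_smul_right, norm_smul, mul_pow, Real.norm_eq_abs, sq_abs]
      simp only [hq]; ring
    have hqd : ∀ t, HasDerivAt q (2 * s + 2 * t * n) t := by
      intro t
      have h1 := ((hasDerivAt_id t).const_mul 2).mul_const s
      have h2 := ((hasDerivAt_id t).pow 2).mul_const n
      refine (((hasDerivAt_const t (R ^ 2 + ‖x‖ ^ 2)).add h1).add h2).congr_deriv ?_
      simp
    have hqd1 : ∀ t, HasDerivAt (fun t => 2 * s + 2 * t * n) (2 * n) t := by
      intro t
      have h1 := ((hasDerivAt_id t).const_mul 2).mul_const n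
      exact (h1.const_add (2 * s)).congr_deriv (by simp)
    -- From |x|² ≤ 2|x + tz|² + 2|tz|² and |tz|² ≤ (R² + |x|²)/4.
    have hq4 : ∀ t ∈ Icc (-1 : ℝ) 1, (R ^ 2 + ‖x‖ ^ 2) / 4 ≤ q t := by
      intro t ht
      rw [← hqn]
      have h1 : ‖x‖ ≤ ‖x + t • z‖ + ‖t • z‖ := by
        simpa using norm_sub_le (x + t • z) (t • z)
      have h2 : ‖t • z‖ ^ 2 ≤ n := by
        rw [norm_smul, mul_pow, Real.norm_eq_abs, sq_abs]
        have : t ^ 2 ≤ 1 := by nlinarith [ht.1, ht.2]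
        nlinarith
      nlinarith [norm_nonneg x, norm_nonneg (t • z), norm_nonneg (x + t • z),
        sq_nonneg (‖x + t • z‖ - ‖t • z‖)]
    have hq0 : ∀ t ∈ Icc (-1 : ℝ) 1, 0 < q t := fun t ht =>
      lt_of_lt_of_le (by positivity) (hq4 t ht)
    have hw : ∀ t ∈ Icc (-1 : ℝ) 1,
        q t ^ (-(a / 2) - 1) ≤ 4 ^ (a / 2 + 1) * bracketWeight R (a + 2) x := by
      intro t ht
      have h1 := Real.rpow_le_rpow_of_nonpos (by positivity) (hq4 t ht)
        (show -(a / 2) - 1 ≤ 0 by linarith)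
      refine h1.trans (le_of_eq ?_)
      unfold bracketWeight
      rw [show -((a + 2) / 2) = -(a / 2 + 1) by ring, show -(a / 2) - 1 = -(a / 2 + 1) by ring,
        Real.div_rpow (by positivity) (by norm_num), Real.rpow_neg (by norm_num : (0 : ℝ) ≤ 4),
        div_inv_eq_mul, mul_comm]
    have key := abs_two_mul_sub_sub_le (h := fun t => cutPower (a / 2) k (q t))
      (h₁ := fun t => d₁ (q t) * (2 * s + 2 * t * n))
      (h₂ := fun t => d₂ (q t) * (2 * s + 2 * t * n) * (2 * s + 2 * t * n) + d₁ (q t) * (2 * n))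
      (B := 6 * C * (4 ^ (a / 2 + 1) * bracketWeight R (a + 2) x) * n)
      (fun t ht => (hd _ (hq0 t ht)).1.comp t (hqd t))
      (fun t ht => ((hd _ (hq0 t ht)).2.1.comp t (hqd t)).mul (hqd1 t)) ?_
    · have e0 : q 0 = R ^ 2 + ‖x‖ ^ 2 := by rw [← hqn]; simp
      have e1 : q 1 = R ^ 2 + ‖x + z‖ ^ 2 := by rw [← hqn]; simp
      have e2 : q (-1) = R ^ 2 + ‖x - z‖ ^ 2 := by rw [← hqn]; simp [sub_eq_add_neg]
      simp only [e0, e1, e2] at key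
      have hb := (bracketWeight_pos hR (a + 2) x).le
      calc |secondDiff (cutWeight R a k) x z| ≤ _ := key
        _ = (12 * C * 4 ^ (a / 2 + 1)) * bracketWeight R (a + 2) x * n := by ring
        _ ≤ _ := by gcongr; exact le_max_right _ _
    · intro t ht
      obtain ⟨-, -, b1, b2⟩ := hd _ (hq0 t ht)
      -- This is q'² ≤ 4qn, the sign of the discriminant of q; it reduces to the Cauchy–Schwarz
      -- bound `hcs`.
      have hsq : (2 * s + 2 * t * n) * (2 * s + 2 * t * n) ≤ 4 * (q t * n) := by
        simp only [hq]; nlinarith [mul_nonneg (sq_nonneg R) hn0]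
      have hp : q t ^ (-(a / 2) - 1) = q t ^ (-(a / 2) - 1 - 1) * q t := by
        rw [← Real.rpow_add_one (hq0 t ht).ne']; congr 1; ring
      have hq2 : 0 ≤ q t ^ (-(a / 2) - 1 - 1) := (Real.rpow_pos_of_pos (hq0 t ht) _).le
      calc _ ≤ |d₂ (q t)| * ((2 * s + 2 * t * n) * (2 * s + 2 * t * n)) + |d₁ (q t)| * (2 * n) := by
            refine (abs_add_le _ _).trans (le_of_eq ?_)
            rw [mul_assoc, abs_mul, abs_mul_self, abs_mul, abs_of_nonneg (by positivity : 0 ≤ 2 * n)]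
        _ ≤ (C * q t ^ (-(a / 2) - 1 - 1)) * (4 * (q t * n)) + (C * q t ^ (-(a / 2) - 1)) * (2 * n) := by
            gcongr
            exact mul_self_nonneg _
        _ = 6 * C * q t ^ (-(a / 2) - 1) * n := by rw [hp]; ring
        _ ≤ _ := by gcongr; exact hw t ht

/-! ### Decay for arbitrary smooth compactly supported functions. -/

lemma abs_secondDiff_le_of_lipschitz {ψ : 𝔼 → ℝ} (hd : Differentiable ℝ ψ) {K : NNReal}
    (hK : LipschitzWith K (fderiv ℝ ψ)) (x z : 𝔼) : |secondDiff ψ x z| ≤ 2 * K * ‖z‖ ^ 2 := by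
  have key : ∀ z, |ψ (x + z) - ψ x - fderiv ℝ ψ x z| ≤ K * ‖z‖ ^ 2 := by
    intro z
    have := (convex_closedBall x ‖z‖).norm_image_sub_le_of_norm_fderiv_le'
      (f := ψ) (φ := fderiv ℝ ψ x) (C := K * ‖z‖) (x := x) (y := x + z) (fun y _ => hd y)
      (fun y hy => ?_) (by simp) (by simp)
    · simpa [sq, mul_assoc] using this
    · have h1 := hK.dist_le_mul y x
      rw [dist_eq_norm] at h1
      exact h1.trans (by gcongr; exact hy)
  have h1 := abs_le.1 (key z)
  have h2 := abs_le.1 (key (-z))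
  rw [map_neg, norm_neg, ← sub_eq_add_neg] at h2
  unfold secondDiff
  rw [abs_le]; constructor <;> linarith [h1.1, h1.2, h2.1, h2.2]

/-- If |x|² ≤ 4L² + 1, where L bounds the support, the weight is at least c and Taylor's bound
suffices. Otherwise x and x ± z all lie outside the support and the second difference is zero. -/
lemma exists_bracketDecay_of_contDiff {ψ : 𝔼 → ℝ} (hψ : ContDiff ℝ ∞ ψ)
    (hc : HasCompactSupport ψ) {a : ℝ} (ha : 0 ≤ a) : ∃ A, BracketDecay 1 a A ψ := by
  have hcont := hψ.continuous
  have hf1 : ContDiff ℝ 1 (fderiv ℝ ψ) := hψ.fderiv_right (by norm_cast)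
  obtain ⟨K, hK⟩ := ContDiff.lipschitzWith_of_hasCompactSupport (hc.fderiv (𝕜 := ℝ)) hf1 one_ne_zero
  obtain ⟨C, hC⟩ := (hc.mul_right (f' := fun x => (bracketWeight 1 a x)⁻¹)).exists_bound_of_continuous
    (by
      exact hcont.mul ((continuous_bracketWeight one_pos a).inv₀
        fun x => (bracketWeight_pos one_pos a x).ne'))
  obtain ⟨L, hL⟩ := hc.isCompact.isBounded.subset_closedBall (0 : 𝔼)
  have hzero : ∀ y, L < ‖y‖ → ψ y = 0 := by
    intro y hy
    by_contra hne
    have := hL (subset_tsupport _ hne)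
    rw [mem_closedBall_zero_iff] at this
    linarith
  set c : ℝ := (2 + 4 * L ^ 2) ^ (-((a + 2) / 2)) with hcdef
  have hcpos : 0 < c := Real.rpow_pos_of_pos (by positivity) _
  refine ⟨max C (2 * K / c), hcont, fun x => ?_, fun x z hz => ?_⟩
  · have hw := bracketWeight_pos one_pos a x
    have := hC x
    rw [Pi.mul_apply, norm_mul, norm_inv, Real.norm_of_nonneg hw.le, ← div_eq_mul_inv, div_le_iff₀ hw] at this
    exact this.trans (by gcongr; exact le_max_left _ _)
  · have hw := bracketWeight_pos one_pos (a + 2) x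
    by_cases hx : ‖x‖ ^ 2 ≤ 4 * L ^ 2 + 1
    · have h1 : c ≤ bracketWeight 1 (a + 2) x :=
        Real.rpow_le_rpow_of_nonpos (by positivity) (by linarith) (by linarith)
      calc _ ≤ 2 * K * ‖z‖ ^ 2 :=
            abs_secondDiff_le_of_lipschitz (hψ.differentiable (by simp)) hK x z
        _ = 2 * K / c * c * ‖z‖ ^ 2 := by field_simp
        _ ≤ _ := by gcongr; exact le_max_right _ _
    · push Not at hx
      have hfar : ∀ v : 𝔼, ‖v‖ ^ 2 ≤ (1 ^ 2 + ‖x‖ ^ 2) / 4 → L < ‖x + v‖ := by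
        intro v hv
        by_contra hle
        push Not at hle
        have h1 : ‖x‖ ≤ ‖x + v‖ + ‖v‖ := by simpa using norm_sub_le (x + v) v
        nlinarith [norm_nonneg x, norm_nonneg v, norm_nonneg (x + v), sq_nonneg (‖x + v‖ - ‖v‖)]
      have e0 : ψ x = 0 := hzero _ (by simpa using hfar 0 (by simp; positivity))
      have e1 : ψ (x + z) = 0 := hzero _ (hfar z hz)
      have e2 : ψ (x - z) = 0 := hzero _ (by
        rw [sub_eq_add_neg]; exact hfar (-z) (by rwa [norm_neg]))
      simp only [secondDiff, e0, e1, e2]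
      have : 0 ≤ max C (2 * K / c) := le_trans (by positivity) (le_max_right _ _)
      simp only [mul_zero, sub_zero, abs_zero]
      positivity

/-! ### Compact exhaustion of (0,T) and weak derivatives in time. -/

lemma exists_Ioo_of_isCompact {T : ℝ} {K : Set ℝ} (hT : 0 < T) (hK : IsCompact K)
    (hKT : K ⊆ Ioo 0 T) : ∃ s t, 0 < s ∧ s < T / 2 ∧ T / 2 < t ∧ t < T ∧ K ⊆ Ioo s t := by
  -- Adding T/2 makes the set nonempty and keeps the base point of the primitives used below inside
  -- the interval.
  have hK' : IsCompact (insert (T / 2) K) := hK.insert _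
  have hne : (insert (T / 2) K).Nonempty := ⟨_, mem_insert _ _⟩
  have hsub : insert (T / 2) K ⊆ Ioo 0 T :=
    insert_subset ⟨by linarith, by linarith⟩ hKT
  obtain ⟨p, hp, hpm⟩ := hK'.exists_isLeast hne
  obtain ⟨q, hq, hqm⟩ := hK'.exists_isGreatest hne
  have h1 := hsub hp
  have h2 := hsub hq
  have h3 := hpm (mem_insert _ _)
  have h4 := hqm (mem_insert _ _)
  refine ⟨p / 2, (q + T) / 2, by linarith [h1.1], by linarith [h1.1], by linarith [h2.2],
    by linarith [h2.2], fun x hx => ⟨?_, ?_⟩⟩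
  · linarith [hpm (mem_insert_of_mem _ hx), h1.1]
  · linarith [hqm (mem_insert_of_mem _ hx), h2.2]

lemma ae_Ioo_of_forall_Icc {T : ℝ} {P : ℝ → Prop}
    (h : ∀ s t, 0 < s → s < t → t < T → ∀ᵐ τ ∂(volume.restrict (Icc s t)), P τ) :
    ∀ᵐ τ ∂(volume.restrict (Ioo 0 T)), P τ := by
  rcases le_or_gt T 0 with hT | hT
  · simp [Ioo_eq_empty (not_lt.2 hT)]
  -- With n + 3 in the denominator the interval is nondegenerate already for n = 0.
  have hn : ∀ n : ℕ, ∀ᵐ τ : ℝ, τ ∈ Icc (T / (n + 3)) (T - T / (n + 3)) → P τ := by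
    intro n
    have h3 : T / (n + 3) ≤ T / 3 := by
      gcongr; linarith [(Nat.cast_nonneg n : (0 : ℝ) ≤ n)]
    have h0 : 0 < T / ((n : ℝ) + 3) := by positivity
    exact (ae_restrict_iff' measurableSet_Icc).1 (h _ _ h0 (by linarith) (by linarith))
  rw [ae_restrict_iff' measurableSet_Ioo]
  filter_upwards [ae_all_iff.2 hn] with τ hτ hmem
  have hd : 0 < min τ (T - τ) := lt_min hmem.1 (by linarith [hmem.2])
  obtain ⟨n, hn⟩ := exists_nat_gt (T / min τ (T - τ))
  refine hτ n ?_
  have h1 : T / ((n : ℝ) + 3) ≤ min τ (T - τ) := by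
    rw [div_lt_iff₀ hd] at hn
    rw [div_le_iff₀ (by positivity)]
    nlinarith
  exact ⟨h1.trans (min_le_left _ _), by linarith [h1.trans (min_le_right _ _)]⟩

section DuBoisReymond

variable {T : ℝ} {Y G : ℝ → ℝ}

lemma integral_deriv_mul_primitive (hT : 0 < T)
    (hG : ∀ s t, 0 < s → s < t → t < T → IntegrableOn G (Icc s t)) {η : ℝ → ℝ}
    (hη : ContDiff ℝ ∞ η) (hc : HasCompactSupport η) (hs : tsupport η ⊆ Ioo 0 T) :
    ∫ t, deriv η t * ∫ τ in (T / 2)..t, G τ = - ∫ t, η t * G t := by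
  obtain ⟨s, t, h0, hs2, ht2, htT, hsub⟩ := exists_Ioo_of_isCompact hT hc hs
  have hst : s < t := by linarith
  have hGi : IntervalIntegrable G volume s t :=
    (intervalIntegrable_iff_integrableOn_Icc_of_le hst.le).2 (hG s t h0 hst htT)
  have hmem : T / 2 ∈ uIcc s t := by rw [uIcc_of_le hst.le]; exact ⟨hs2.le, ht2.le⟩
  have hP := hGi.absolutelyContinuousOnInterval_intervalIntegral hmem
  have hηa : AbsolutelyContinuousOnInterval η s t :=
    (hη.of_le (by norm_cast)).contDiffOn.absolutelyContinuousOnInterval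
  have hibp := hP.integral_mul_deriv_eq_deriv_mul hηa
  have hz : ∀ x, x ∉ Ioo s t → η x = 0 := fun x hx => image_eq_zero_of_notMem_tsupport
    fun h => hx (hsub h)
  rw [hz s (by simp), hz t (by simp)] at hibp
  have e1 : ∫ x in s..t, (∫ τ in (T / 2)..x, G τ) * deriv η x =
      ∫ x, deriv η x * ∫ τ in (T / 2)..x, G τ := by
    rw [intervalIntegral.integral_eq_integral_of_support_subset]
    · congr 1; ext x; ring
    · intro x hx
      have : x ∈ tsupport (deriv η) := subset_tsupport _ (right_ne_zero_of_mul hx)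
      exact Ioo_subset_Ioc_self (hsub (tsupport_deriv_subset this))
  have e2 : ∫ x in s..t, deriv (fun x => ∫ τ in (T / 2)..x, G τ) x * η x = ∫ x, η x * G x := by
    rw [← intervalIntegral.integral_eq_integral_of_support_subset (a := s) (b := t)]
    · refine intervalIntegral.integral_congr_ae ?_
      filter_upwards [hGi.ae_hasDerivAt_integral] with x hx hxm
      rw [(hx (uIoc_subset_uIcc hxm) _ hmem).deriv, mul_comm]
    · intro x hx
      by_contra hxn
      exact hx (by simp [hz x fun h => hxn (Ioo_subset_Ioc_self h)])
  rw [← e1, hibp, e2]; ring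

/-- The lemma of du Bois-Reymond: a weak derivative that is locally integrable gives an
absolutely continuous representative. -/
lemma ae_eq_const_sub_primitive (hT : 0 < T)
    (hY : ∀ s t, 0 < s → s < t → t < T → IntegrableOn Y (Icc s t))
    (hG : ∀ s t, 0 < s → s < t → t < T → IntegrableOn G (Icc s t))
    (h : ∀ η : ℝ → ℝ, ContDiff ℝ ∞ η → HasCompactSupport η → tsupport η ⊆ Ioo 0 T →
      ∫ t, deriv η t * Y t = ∫ t, η t * G t) :
    ∃ c, ∀ᵐ t ∂(volume.restrict (Ioo 0 T)), Y t = c - ∫ τ in (T / 2)..t, G τ := by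
  set F : ℝ → ℝ := fun t => Y t + ∫ τ in (T / 2)..t, G τ with hF
  have hPc : ∀ s t, 0 < s → s < t → t < T →
      ContinuousOn (fun x => ∫ τ in (T / 2)..x, G τ) (Icc s t) := by
    intro s t h0 hst htT
    have h1 : 0 < min s (T / 2) := lt_min h0 (by linarith)
    have h2 : max t (T / 2) < T := max_lt htT (by linarith)
    have h3 : min s (T / 2) < max t (T / 2) :=
      (min_le_left _ _).trans_lt (hst.trans_le (le_max_left _ _))
    have := intervalIntegral.continuousOn_primitive_interval' (a := T / 2)
      ((intervalIntegrable_iff_integrableOn_Icc_of_le h3.le).2 (hG _ _ h1 h3 h2))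
      (by rw [uIcc_of_le h3.le]; exact ⟨min_le_right _ _, le_max_right _ _⟩)
    rw [uIcc_of_le h3.le] at this
    exact this.mono (Icc_subset_Icc (min_le_left _ _) (le_max_left _ _))
  have hFi : ∀ s t, 0 < s → s < t → t < T → IntegrableOn F (Icc s t) := fun s t h0 hst htT =>
    (hY s t h0 hst htT).add ((hPc s t h0 hst htT).integrableOn_Icc)
  have hmul : ∀ f : ℝ → ℝ, (∀ s t, 0 < s → s < t → t < T → IntegrableOn f (Icc s t)) →
      ∀ φ : ℝ → ℝ, Continuous φ → HasCompactSupport φ → tsupport φ ⊆ Ioo 0 T →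
      Integrable (fun x => φ x * f x) := by
    intro f hf φ hφ hc hs
    obtain ⟨s, t, h0, hs2, ht2, htT, hsub⟩ := exists_Ioo_of_isCompact hT hc hs
    have h1 := (hf s t h0 (by linarith) htT).continuousOn_mul hφ.continuousOn isCompact_Icc
    refine (integrableOn_iff_integrable_of_support_subset fun x hx => ?_).1 h1
    exact Ioo_subset_Icc_self (hsub (subset_tsupport _ (left_ne_zero_of_mul hx)))
  -- F has zero distributional derivative; it remains to see that F is constant almost everywhere.
  have hF0 : ∀ η : ℝ → ℝ, ContDiff ℝ ∞ η → HasCompactSupport η → tsupport η ⊆ Ioo 0 T →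
      ∫ t, deriv η t * F t = 0 := by
    intro η hη hc hs
    have hd : Continuous (deriv η) := hη.continuous_deriv (by simp)
    have hs' : tsupport (deriv η) ⊆ Ioo 0 T := tsupport_deriv_subset.trans hs
    have i1 := hmul Y hY _ hd hc.deriv hs'
    have i2 := hmul _ (fun s t h0 hst htT => (hPc s t h0 hst htT).integrableOn_Icc) _ hd hc.deriv hs'
    have e : (fun t => deriv η t * F t) =
        fun t => deriv η t * Y t + deriv η t * ∫ τ in (T / 2)..t, G τ := by
      ext t; simp only [hF]; ring
    rw [e, integral_add i1 i2, h η hη hc hs, integral_deriv_mul_primitive hT hG hη hc hs]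
    ring
  let b : ContDiffBump (T / 2) := ⟨T / 8, T / 4, by positivity, by linarith⟩
  set φ₀ : ℝ → ℝ := b.normed volume with hφ₀
  have hφ₀s : ContDiff ℝ ∞ φ₀ := b.contDiff_normed
  have hφ₀c : HasCompactSupport φ₀ := b.hasCompactSupport_normed
  have hφ₀t : tsupport φ₀ ⊆ Ioo 0 T := by
    rw [hφ₀, b.tsupport_normed_eq, Real.closedBall_eq_Icc]
    intro x hx
    have h1 : T / 2 - T / 4 ≤ x := hx.1
    have h2 : x ≤ T / 2 + T / 4 := hx.2
    exact ⟨by linarith, by linarith⟩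
  have hφ₀i : ∫ t, φ₀ t = 1 := b.integral_normed
  refine ⟨∫ t, φ₀ t * F t, ?_⟩
  set c := ∫ t, φ₀ t * F t with hc
  have hzero : ∀ g : ℝ → ℝ, ContDiff ℝ ∞ g → HasCompactSupport g → tsupport g ⊆ Ioo 0 T →
      ∫ x, g x • (F x - c) = 0 := by
    intro g hg hgc hgs
    set κ := ∫ t, g t with hκ
    -- Subtracting κφ₀ leaves mean zero, so the primitive of w has compact support and is admissible
    -- in `hF0`. Thus F pairs with g as the constant c does.
    set w : ℝ → ℝ := fun t => g t - κ * φ₀ t with hw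
    have hwc : Continuous w := hg.continuous.sub (continuous_const.mul hφ₀s.continuous)
    have hws : ContDiff ℝ ∞ w := hg.sub (contDiff_const.mul hφ₀s)
    obtain ⟨s, t, h0, hs2, ht2, htT, hsub⟩ := exists_Ioo_of_isCompact hT
      (hgc.isCompact.union hφ₀c.isCompact) (union_subset hgs hφ₀t)
    have hst : s < t := by linarith
    have hwz : ∀ x, x ∉ Ioo s t → w x = 0 := by
      intro x hx
      have h1 : g x = 0 := image_eq_zero_of_notMem_tsupport fun h => hx (hsub (Or.inl h))
      have h2 : φ₀ x = 0 := image_eq_zero_of_notMem_tsupport fun h => hx (hsub (Or.inr h))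
      simp [hw, h1, h2]
    have hgi : Integrable g := hg.continuous.integrable_of_hasCompactSupport hgc
    have hφ₀ii : Integrable φ₀ := hφ₀s.continuous.integrable_of_hasCompactSupport hφ₀c
    have hwi : ∫ x, w x = 0 := by
      simp only [hw]
      rw [integral_sub hgi (hφ₀ii.const_mul κ), integral_const_mul, hφ₀i]; simp [hκ]
    set η : ℝ → ℝ := fun x => ∫ τ in s..x, w τ with hη
    have hηd : ∀ x, HasDerivAt η (w x) x := fun x =>
      intervalIntegral.integral_hasDerivAt_right (hwc.intervalIntegrable _ _)
        (hwc.stronglyMeasurableAtFilter _ _) hwc.continuousAt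
    have hder : deriv η = w := funext fun x => (hηd x).deriv
    have hηs : ContDiff ℝ ∞ η := by
      rw [contDiff_infty_iff_deriv]
      exact ⟨fun x => (hηd x).differentiableAt, by rw [hder]; exact hws⟩
    have hη0 : ∀ x, x ∉ Icc s t → η x = 0 := by
      intro x hx
      rw [mem_Icc, not_and_or, not_le, not_le] at hx
      rcases hx with hx | hx
      · simp only [hη]
        rw [intervalIntegral.integral_zero_ae]
        refine Eventually.of_forall fun y hy => hwz y fun h => ?_
        rw [uIoc_of_ge hx.le] at hy
        linarith [hy.2, h.1]
      · simp only [hη]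
        rw [intervalIntegral.integral_eq_integral_of_support_subset, hwi]
        intro y hy
        by_contra hyn
        exact hy (hwz y fun h => hyn ⟨h.1, by linarith [h.2]⟩)
    have hηt : tsupport η ⊆ Icc s t := by
      refine closure_minimal (fun x hx => ?_) isClosed_Icc
      by_contra hn
      exact hx (hη0 x hn)
    have hηc : HasCompactSupport η := HasCompactSupport.intro isCompact_Icc hη0
    have key := hF0 η hηs hηc (hηt.trans (Icc_subset_Ioo h0 htT))
    rw [hder] at key
    have i1 := hmul F hFi g hg.continuous hgc hgs
    have i2 := hmul F hFi φ₀ hφ₀s.continuous hφ₀c hφ₀t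
    have e1 : (fun x => w x * F x) = fun x => g x * F x - κ * (φ₀ x * F x) := by
      ext x; simp only [hw]; ring
    rw [e1, integral_sub i1 (i2.const_mul κ), integral_const_mul] at key
    have e2 : (fun x => g x • (F x - c)) = fun x => g x * F x - c * g x := by
      ext x; simp only [smul_eq_mul]; ring
    rw [e2, integral_sub i1 (hgi.const_mul c), integral_const_mul]
    linarith [mul_comm κ c]
  have hloc : LocallyIntegrableOn (fun x => F x - c) (Ioo 0 T) := by
    rw [locallyIntegrableOn_iff isOpen_Ioo.isLocallyClosed]
    intro K hKs hK
    obtain ⟨s, t, h0, hs2, ht2, htT, hsub⟩ := exists_Ioo_of_isCompact hT hK hKs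
    have := (hFi s t h0 (by linarith) htT).sub
      (integrableOn_const (C := c) (hs := by simp) (hC := by simp))
    exact this.mono_set (hsub.trans Ioo_subset_Icc_self)
  have := isOpen_Ioo.ae_eq_zero_of_integral_contDiff_smul_eq_zero hloc hzero
  rw [ae_restrict_iff' measurableSet_Ioo]
  filter_upwards [this] with x hx hxm
  have := hx hxm
  simp only [hF] at this
  linarith

end DuBoisReymond

/-! ### Moments of a solution as absolutely continuous functions of time. -/

section

variable {σ m T : ℝ} {u : ℝ → EuclideanSpace ℝ (Fin N) → ℝ}

/-- The integral `∫ |u(t)|^m ρ dx`. -/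
def powMass (σ m : ℝ) (u : ℝ → EuclideanSpace ℝ (Fin N) → ℝ) (t : ℝ) : ℝ :=
  ∫ x, |signedPow m (u t x)| * rhoWeight σ x

lemma rhoWeight_pos (σ : ℝ) (x : 𝔼) : 0 < rhoWeight σ x :=
  Real.rpow_pos_of_pos (by positivity) _

lemma continuous_rhoWeight (σ : ℝ) : Continuous (rhoWeight (N := N) σ) := by
  unfold rhoWeight
  refine Continuous.rpow_const (by fun_prop) fun x => Or.inl ?_
  positivity

lemma powMass_nonneg (t : ℝ) : 0 ≤ powMass σ m u t :=
  integral_nonneg fun x => mul_nonneg (abs_nonneg _) (rhoWeight_pos σ x).le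

lemma LocL1Weighted.ae_integrable {w : 𝔼 → ℝ} {f : ℝ → EuclideanSpace ℝ (Fin N) → ℝ}
    (h : LocL1Weighted T w f) :
    ∀ᵐ t ∂(volume.restrict (Ioo 0 T)), Integrable (fun x => f t x * w x) := by
  refine ae_Ioo_of_forall_Icc fun s t h0 hst htT => ?_
  have := h s t h0 hst htT
  rw [IntegrableOn, Measure.volume_eq_prod, ← Measure.prod_restrict, Measure.restrict_univ] at this
  exact this.prod_right_ae

lemma LocL1Weighted.integrableOn_integral {w : 𝔼 → ℝ} {f : ℝ → EuclideanSpace ℝ (Fin N) → ℝ}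
    (h : LocL1Weighted T w f) {s t : ℝ} (h0 : 0 < s) (hst : s < t) (htT : t < T) :
    IntegrableOn (fun t => ∫ x, f t x * w x) (Icc s t) := by
  have := h s t h0 hst htT
  rw [IntegrableOn, Measure.volume_eq_prod, ← Measure.prod_restrict, Measure.restrict_univ] at this
  exact this.integral_prod_left

lemma LocL1Loc.locL1Weighted {f : ℝ → EuclideanSpace ℝ (Fin N) → ℝ} (h : LocL1Loc T f) {w : 𝔼 → ℝ}
    (hw : Continuous w) (hc : HasCompactSupport w) : LocL1Weighted T w f := by
  intro s t h0 hst htT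
  obtain ⟨C, hC⟩ := hc.exists_bound_of_continuous hw
  have h1 := h s t h0 hst htT (tsupport w) hc.isCompact
  have h2 : IntegrableOn (fun p : ℝ × 𝔼 => f p.1 p.2 * w p.2) (Icc s t ×ˢ tsupport w) :=
    Integrable.mul_bdd (c := C) h1 (hw.comp continuous_snd).aestronglyMeasurable
      (Eventually.of_forall fun p => hC p.2)
  refine h2.of_forall_sdiff_eq_zero (measurableSet_Icc.prod MeasurableSet.univ) fun p hp => ?_
  have : p.2 ∉ tsupport w := fun h => hp.2 ⟨hp.1.1, h⟩
  simp [image_eq_zero_of_notMem_tsupport this]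

lemma LocL1Weighted.of_le_mul {f : ℝ → EuclideanSpace ℝ (Fin N) → ℝ} {w v : 𝔼 → ℝ}
    (h : LocL1Weighted T w f) (hw : ∀ x, 0 < w x) (hwm : Measurable w) (hvm : Measurable v) {C : ℝ}
    (hC : ∀ x, |v x| ≤ C * w x) : LocL1Weighted T v f := by
  intro s t h0 hst htT
  have h1 := h s t h0 hst htT
  have h2 : IntegrableOn (fun p : ℝ × 𝔼 => (f p.1 p.2 * w p.2) * (v p.2 / w p.2))
      (Icc s t ×ˢ univ) := by
    refine Integrable.mul_bdd (c := C) h1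
      ((hvm.comp measurable_snd).div (hwm.comp measurable_snd)).aestronglyMeasurable
      (Eventually.of_forall fun p => ?_)
    rw [norm_div, Real.norm_of_nonneg (hw _).le, div_le_iff₀ (hw _)]
    exact hC p.2
  refine h2.congr (Eventually.of_forall fun p => ?_)
  have := (hw p.2).ne'
  simp only []
  field_simp

lemma LocL1Weighted.abs {f : ℝ → EuclideanSpace ℝ (Fin N) → ℝ} {w : 𝔼 → ℝ}
    (h : LocL1Weighted T w f) (hw : ∀ x, 0 < w x) :
    LocL1Weighted T w (fun t x => |f t x|) := by
  intro s t h0 hst htT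
  refine (h s t h0 hst htT).norm.congr (Eventually.of_forall fun p => ?_)
  simp only [norm_mul, Real.norm_eq_abs, abs_of_pos (hw p.2)]

/-- Fubini's theorem for the product of a test function of time and a function that is locally
integrable in time. -/
lemma LocL1Weighted.setIntegral_eq (hT : 0 < T) {f : ℝ → EuclideanSpace ℝ (Fin N) → ℝ} {w : 𝔼 → ℝ}
    (h : LocL1Weighted T w f) {η : ℝ → ℝ} (hη : Continuous η) (hc : HasCompactSupport η)
    (hs : tsupport η ⊆ Ioo 0 T) :
    ∫ p in Ioo 0 T ×ˢ (univ : Set 𝔼), f p.1 p.2 * (η p.1 * w p.2) =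
      ∫ t, η t * ∫ x, f t x * w x := by
  obtain ⟨s, t, h0, hs2, ht2, htT, hsub⟩ := exists_Ioo_of_isCompact hT hc hs
  obtain ⟨C, hC⟩ := hc.exists_bound_of_continuous hη
  have hz : ∀ r, r ∉ Icc s t → η r = 0 := fun r hr => image_eq_zero_of_notMem_tsupport
    fun h => hr (Ioo_subset_Icc_self (hsub h))
  have h1 : IntegrableOn (fun p : ℝ × 𝔼 => f p.1 p.2 * (η p.1 * w p.2)) (Icc s t ×ˢ univ) := by
    have := Integrable.bdd_mul (h s t h0 (by linarith) htT)
      (f := fun p : ℝ × 𝔼 => η p.1) (c := C)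
      (hη.comp continuous_fst).aestronglyMeasurable (Eventually.of_forall fun p => hC p.1)
    exact this.congr (Eventually.of_forall fun p => by simp only []; ring)
  have h2 : Integrable (fun p : ℝ × 𝔼 => f p.1 p.2 * (η p.1 * w p.2)) := by
    refine (integrableOn_iff_integrable_of_support_subset fun p hp => ?_).1 h1
    refine ⟨?_, mem_univ _⟩
    by_contra hn
    exact hp (by simp [hz _ hn])
  rw [setIntegral_eq_integral_of_forall_compl_eq_zero]
  · rw [Measure.volume_eq_prod] at h2 ⊢
    rw [integral_prod _ h2]
    congr 1; ext r
    rw [← integral_const_mul]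
    congr 1; ext x; ring
  · intro p hp
    have : p.1 ∉ Icc s t := fun h => hp ⟨Icc_subset_Ioo h0 htT h, mem_univ _⟩
    simp [hz _ this]

lemma isTestFunction_mul {η : ℝ → ℝ} (hη : ContDiff ℝ ∞ η) (hηc : HasCompactSupport η)
    (hηs : tsupport η ⊆ Ioo 0 T) {ψ : 𝔼 → ℝ} (hψ : ContDiff ℝ ∞ ψ) (hψc : HasCompactSupport ψ) :
    IsTestFunction T (fun p : ℝ × EuclideanSpace ℝ (Fin N) => η p.1 * ψ p.2) := by
  have hsub : tsupport (fun p : ℝ × 𝔼 => η p.1 * ψ p.2) ⊆ tsupport η ×ˢ tsupport ψ := by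
    refine closure_minimal (fun p hp => ⟨?_, ?_⟩)
      ((isClosed_tsupport η).prod (isClosed_tsupport ψ))
    · exact subset_tsupport _ (left_ne_zero_of_mul hp)
    · exact subset_tsupport _ (right_ne_zero_of_mul hp)
  refine ⟨(hη.comp contDiff_fst).mul (hψ.comp contDiff_snd), ?_,
    fun p hp => ⟨hηs (hsub hp).1, mem_univ _⟩⟩
  exact (hηc.isCompact.prod hψc.isCompact).of_isClosed_subset (isClosed_tsupport _) hsub

variable {R a A : ℝ} {ψ : EuclideanSpace ℝ (Fin N) → ℝ}

/-- The moment `∫ u(t) ψ dx` of a very weak solution has an absolutely continuous representative,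
whose increments are controlled by `∫ |u|^m ρ`. -/
lemma IsVeryWeakSolution.exists_moment_repr (hN : 1 ≤ N) (hσ : 0 < σ) (hσ2 : σ < 2) (hT : 0 < T)
    (hu : IsVeryWeakSolution σ m T u) (hR : 1 ≤ R) (ha : (N : ℝ) < a) (h : BracketDecay R a A ψ)
    (hψ : ContDiff ℝ ∞ ψ) (hψc : HasCompactSupport ψ) :
    ∃ P : ℝ → ℝ, (∀ᵐ t ∂(volume.restrict (Ioo 0 T)), ∫ x, u t x * ψ x = P t) ∧
      ∀ s t, 0 < s → s < t → t < T → |P t - P s| ≤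
        fracLapBound N σ a * A * R ^ ((N : ℝ) - a) * ∫ τ in s..t, powMass σ m u τ := by
  have hR0 : 0 < R := by linarith
  have hY : LocL1Weighted T ψ u := hu.locL1.locL1Weighted hψ.continuous hψc
  have hle := h.abs_fracLaplacian_le_rho hN hσ hσ2 hR ha
  have hG : LocL1Weighted T (fracLaplacian σ ψ) (fun t x => signedPow m (u t x)) :=
    hu.pow_locL1.of_le_mul (rhoWeight_pos σ) (continuous_rhoWeight σ).measurable
      (h.measurable_fracLaplacian hN hσ hσ2 hR0 ha) hle
  have hρ := hu.pow_locL1.abs (rhoWeight_pos σ)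
  set C := fracLapBound N σ a * A * R ^ ((N : ℝ) - a) with hCdef
  set G : ℝ → ℝ := fun t => ∫ x, signedPow m (u t x) * fracLaplacian σ ψ x with hGdef
  obtain ⟨c, hc⟩ := ae_eq_const_sub_primitive hT (Y := fun t => ∫ x, u t x * ψ x) (G := G)
    (fun s t h0 hst htT => hY.integrableOn_integral h0 hst htT)
    (fun s t h0 hst htT => hG.integrableOn_integral h0 hst htT) (by
      intro η hη hηc hηs
      have heq := hu.equation _ (isTestFunction_mul hη hηc hηs hψ hψc)
      have e1 : ∀ p : ℝ × 𝔼, deriv (fun s => η s * ψ p.2) p.1 = deriv η p.1 * ψ p.2 := fun p =>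
        deriv_mul_const ((hη.differentiable (by simp)) p.1) _
      have e2 : ∀ p : ℝ × 𝔼, fracLaplacian σ (fun x => η p.1 * ψ x) p.2 =
          η p.1 * fracLaplacian σ ψ p.2 := fun p =>
        h.fracLaplacian_const_mul hN hσ hσ2 hR0 ha _ _
      simp only [e1, e2] at heq
      rw [hY.setIntegral_eq hT (hη.continuous_deriv (by simp)) hηc.deriv
        (tsupport_deriv_subset.trans hηs), hG.setIntegral_eq hT hη.continuous hηc hηs] at heq
      linarith)
  refine ⟨fun t => c - ∫ τ in (T / 2)..t, G τ, hc, fun s t h0 hst htT => ?_⟩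
  have hint : ∀ r q, 0 < r → r < T → 0 < q → q < T → IntervalIntegrable G volume r q := by
    have key : ∀ r q, 0 < r → r ≤ q → q < T → IntervalIntegrable G volume r q := by
      intro r q hr hrq hq
      rcases hrq.eq_or_lt with rfl | hrq
      · exact IntervalIntegrable.refl
      · exact (intervalIntegrable_iff_integrableOn_Icc_of_le hrq.le).2
          (hG.integrableOn_integral hr hrq hq)
    intro r q hr hrT hq hqT
    rcases le_total r q with hrq | hrq
    · exact key r q hr hrq hqT
    · exact (key q r hq hrq hrT).symm
  have e : (c - ∫ τ in (T / 2)..t, G τ) - (c - ∫ τ in (T / 2)..s, G τ) = - ∫ τ in s..t, G τ := by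
    rw [← intervalIntegral.integral_interval_sub_left (a := T / 2) (b := t) (c := s)
      (hint _ _ (by linarith) (by linarith) (by linarith) htT)
      (hint _ _ (by linarith) (by linarith) h0 (by linarith))]
    ring
  have hgi : IntervalIntegrable (powMass σ m u) volume s t :=
    (intervalIntegrable_iff_integrableOn_Icc_of_le hst.le).2 (hρ.integrableOn_integral h0 hst htT)
  simp only [e, abs_neg]
  rw [← intervalIntegral.integral_const_mul]
  rw [← Real.norm_eq_abs]
  refine intervalIntegral.norm_integral_le_of_norm_le hst.le ?_ (hgi.const_mul C)
  have hae := (ae_restrict_iff' measurableSet_Ioo).1 hρ.ae_integrable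
  filter_upwards [hae] with τ hτ hmem
  have hi := hτ ⟨by linarith [hmem.1], by linarith [hmem.2]⟩
  simp only [hGdef, powMass]
  rw [← integral_const_mul]
  refine norm_integral_le_of_norm_le (hi.const_mul C) (Eventually.of_forall fun x => ?_)
  rw [norm_mul, Real.norm_eq_abs, Real.norm_eq_abs]
  have := mul_le_mul_of_nonneg_left (hle x) (abs_nonneg (signedPow m (u τ x)))
  linarith

end

/-! ### Boundedness of the weighted mass near t = 0, and tightness. -/

section

variable {σ m T a R : ℝ} {u : ℝ → EuclideanSpace ℝ (Fin N) → ℝ}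

/-- The weighted mass `∫ u(t) (R² + |x|²)^{-a/2} dx`. -/
def weightedMass (R a : ℝ) (u : ℝ → EuclideanSpace ℝ (Fin N) → ℝ) (t : ℝ) : ℝ :=
  ∫ x, u t x * bracketWeight R a x

lemma bracketWeight_le_one_bracketWeight (hR : 1 ≤ R) (ha : 0 ≤ a) (x : 𝔼) :
    bracketWeight R a x ≤ bracketWeight 1 a x :=
  Real.rpow_le_rpow_of_nonpos (by positivity) (by nlinarith) (by linarith)

lemma integrable_mul_of_abs_le {f w v : 𝔼 → ℝ} (h : Integrable fun x => f x * w x)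
    (hw : ∀ x, 0 < w x) (hwm : Measurable w) (hvm : Measurable v) {C : ℝ}
    (hC : ∀ x, |v x| ≤ C * w x) : Integrable fun x => f x * v x := by
  have h2 : Integrable (fun x => (f x * w x) * (v x / w x)) := by
    refine Integrable.mul_bdd (c := C) h (hvm.div hwm).aestronglyMeasurable
      (Eventually.of_forall fun p => ?_)
    rw [norm_div, Real.norm_of_nonneg (hw _).le, div_le_iff₀ (hw _)]
    exact hC p
  refine h2.congr (Eventually.of_forall fun p => ?_)
  have := (hw p).ne'
  simp only []
  field_simp

lemma integrable_mul_bracketWeight (hR : 1 ≤ R) (ha : 0 ≤ a) {f : 𝔼 → ℝ}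
    (h : Integrable fun x => f x * bracketWeight 1 a x) :
    Integrable fun x => f x * bracketWeight R a x := by
  have hR0 : 0 < R := by linarith
  refine integrable_mul_of_abs_le h (bracketWeight_pos one_pos a)
    (continuous_bracketWeight one_pos a).measurable (continuous_bracketWeight hR0 a).measurable
    (C := 1) fun x => ?_
  rw [abs_of_pos (bracketWeight_pos hR0 a x), one_mul]
  exact bracketWeight_le_one_bracketWeight hR ha x

lemma tendsto_integral_cutWeight (hR : 1 ≤ R) (ha : 0 ≤ a) {f : 𝔼 → ℝ}
    (h : Integrable fun x => f x * bracketWeight 1 a x) :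
    Tendsto (fun k : ℕ => ∫ x, f x * cutWeight R a ((k : ℝ) + 1) x) atTop
      (𝓝 (∫ x, f x * bracketWeight R a x)) := by
  have hR0 : 0 < R := by linarith
  have hi := integrable_mul_bracketWeight hR ha h
  have hle : ∀ (k : ℕ) (x : 𝔼), |cutWeight R a ((k : ℝ) + 1) x| ≤ bracketWeight R a x := by
    intro k x
    rw [abs_of_nonneg (cutWeight_nonneg hR0 a _ x)]
    exact cutWeight_le hR0 a _ x
  refine tendsto_integral_filter_of_dominated_convergence _ (Eventually.of_forall fun k => ?_)
    (Eventually.of_forall fun k => Eventually.of_forall fun x => ?_) hi.norm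
    (Eventually.of_forall fun x => ?_)
  · refine (integrable_mul_of_abs_le hi (bracketWeight_pos hR0 a)
      (continuous_bracketWeight hR0 a).measurable
      (contDiff_cutWeight hR0 a _).continuous.measurable (C := 1) fun x => ?_).aestronglyMeasurable
    rw [one_mul]; exact hle k x
  · rw [norm_mul, norm_mul]
    gcongr
    rw [Real.norm_of_nonneg (bracketWeight_pos hR0 a x).le]
    exact hle k x
  · refine tendsto_const_nhds.congr' ?_
    obtain ⟨n, hn⟩ := exists_nat_gt (R ^ 2 + ‖x‖ ^ 2)
    filter_upwards [eventually_ge_atTop n] with k hk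
    have hk' : (n : ℝ) ≤ k := by exact_mod_cast hk
    rw [cutWeight_eq, cutoff_eq_one, mul_one]
    rw [div_le_one (by positivity)]
    linarith

/-- Increments of the weighted masses, with decay in `R`. -/
lemma IsVeryWeakSolution.exists_weightedMass_increment (hN : 1 ≤ N) (hσ : 0 < σ) (hσ2 : σ < 2)
    (hT : 0 < T) (hu : IsVeryWeakSolution σ m T u) (ha : (N : ℝ) < a)
    (hw : LocL1Weighted T (bracketWeight 1 a) u) :
    ∃ C, 0 ≤ C ∧ ∀ R, 1 ≤ R → ∃ S : Set ℝ, (∀ᵐ t ∂(volume.restrict (Ioo 0 T)), t ∈ S) ∧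
      ∀ s ∈ S, ∀ t ∈ S, 0 < s → s < t → t < T →
        |weightedMass R a u t - weightedMass R a u s| ≤
          C * R ^ ((N : ℝ) - a) * ∫ τ in s..t, powMass σ m u τ := by
  have ha0 : 0 ≤ a := (Nat.cast_nonneg N).trans ha.le
  obtain ⟨A, hA⟩ := exists_bracketDecay_cutWeight N ha0
  have hA0 : 0 ≤ A := (hA 1 one_pos 1 one_pos).nonneg one_pos
  refine ⟨fracLapBound N σ a * A, mul_nonneg (fracLapBound_nonneg N σ a) hA0, fun R hR => ?_⟩
  have hR0 : 0 < R := by linarith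
  -- Only countably many truncations are used, so one set of full measure serves all of them and k →
  -- ∞ can be taken at fixed times.
  choose P hP hPi using fun k : ℕ => hu.exists_moment_repr hN hσ hσ2 hT hR ha
    (hA R hR0 ((k : ℝ) + 1) (by positivity)) (contDiff_cutWeight hR0 a _)
    (hasCompactSupport_cutWeight R a (by positivity))
  refine ⟨{t | (Integrable fun x => u t x * bracketWeight 1 a x) ∧
    ∀ k : ℕ, ∫ x, u t x * cutWeight R a ((k : ℝ) + 1) x = P k t}, ?_, ?_⟩
  · filter_upwards [hw.ae_integrable, ae_all_iff.2 hP] with t h1 h2 using ⟨h1, h2⟩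
  · intro s hs t ht h0 hst htT
    have l1 := tendsto_integral_cutWeight hR ha0 hs.1
    have l2 := tendsto_integral_cutWeight hR ha0 ht.1
    refine le_of_tendsto (l2.sub l1).abs (Eventually.of_forall fun k => ?_)
    rw [hs.2 k, ht.2 k]
    exact hPi k s t h0 hst htT

/-- The exponent of the weight that remains after Young's inequality. -/
def youngExponent (N : ℕ) (σ m a : ℝ) : ℝ := (N + σ - a * m) / (1 - m)

/-- The upper limit on a enters here: the inequality amounts to (a - N)m < σ. -/
lemma lt_youngExponent (hm : 0 < m) (hm1 : m < 1) (ha : a < N + σ / m) :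
    (N : ℝ) < youngExponent N σ m a := by
  unfold youngExponent
  rw [lt_div_iff₀ (by linarith)]
  have : (a - N) * m < σ := by
    rw [← lt_div_iff₀ hm]; linarith
  nlinarith

/-- The exponent is chosen so that ρ = w_a^m w_{a'}^{1-m}; weighted arithmetic–geometric means then
separate u from the remaining weight. -/
lemma abs_signedPow_mul_rhoWeight_le (hm : 0 < m) (hm1 : m < 1) {c : ℝ} (hc : 0 ≤ c) (x : 𝔼) :
    |signedPow m c| * rhoWeight σ x ≤
      c * bracketWeight 1 a x + bracketWeight 1 (youngExponent N σ m a) x := by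
  have hw := bracketWeight_pos one_pos a x
  have hb := bracketWeight_pos one_pos (youngExponent N σ m a) x
  have hq : 0 < 1 ^ 2 + ‖x‖ ^ 2 := by positivity
  have h1 : |signedPow m c| ≤ c ^ m := by
    unfold signedPow
    rw [abs_mul, abs_of_nonneg (by positivity : 0 ≤ |c| ^ m), abs_of_nonneg hc]
    refine mul_le_of_le_one_left (by positivity) ?_
    rcases hc.eq_or_lt with rfl | hc
    · simp
    · simp [Real.sign_of_pos hc]
  have h2 : rhoWeight σ x = bracketWeight 1 a x ^ m *
      bracketWeight 1 (youngExponent N σ m a) x ^ (1 - m) := by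
    unfold rhoWeight bracketWeight
    rw [← Real.rpow_mul hq.le, ← Real.rpow_mul hq.le, ← Real.rpow_add hq, one_pow]
    congr 1
    unfold youngExponent
    have : 1 - m ≠ 0 := by linarith
    field_simp
    ring
  have h3 := Real.geom_mean_le_arith_mean2_weighted hm.le (by linarith : 0 ≤ 1 - m)
    (mul_nonneg hc hw.le) hb.le (by ring)
  rw [Real.mul_rpow hc hw.le] at h3
  have h4 : 0 ≤ c * bracketWeight 1 a x := mul_nonneg hc hw.le
  calc _ ≤ c ^ m * rhoWeight σ x := by gcongr; exact (rhoWeight_pos σ x).le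
    _ ≤ m * (c * bracketWeight 1 a x) + (1 - m) * bracketWeight 1 (youngExponent N σ m a) x := by
      rw [h2, ← mul_assoc]; exact h3
    _ ≤ _ := by nlinarith

/-- The additive constant in the bound of `∫ |u|^m ρ` by the weighted mass. -/
def youngConst (N : ℕ) (σ m a : ℝ) : ℝ :=
  ∫ x : EuclideanSpace ℝ (Fin N), bracketWeight 1 (youngExponent N σ m a) x

lemma youngConst_nonneg (N : ℕ) (σ m a : ℝ) : 0 ≤ youngConst N σ m a :=
  integral_nonneg fun x => (bracketWeight_pos one_pos _ x).le

lemma powMass_le (hm : 0 < m) (hm1 : m < 1) (ha : a < N + σ / m) {t : ℝ}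
    (hpos : ∀ᵐ x, 0 ≤ u t x) (hi : Integrable fun x => u t x * bracketWeight 1 a x) :
    powMass σ m u t ≤ weightedMass 1 a u t + youngConst N σ m a := by
  have hb := integrable_bracketWeight_one (N := N) (lt_youngExponent hm hm1 ha)
  unfold powMass weightedMass youngConst
  rw [← integral_add hi hb]
  refine integral_mono_of_nonneg
    (Eventually.of_forall fun x => mul_nonneg (abs_nonneg _) (rhoWeight_pos σ x).le)
    (hi.add hb) ?_
  filter_upwards [hpos] with x hx
  exact abs_signedPow_mul_rhoWeight_le hm hm1 hx x

lemma exists_mem_of_ae_Ioo {S : Set ℝ} (hS : ∀ᵐ t ∂(volume.restrict (Ioo 0 T)), t ∈ S) {b : ℝ}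
    (hb : 0 < b) (hT : 0 < T) : ∃ t ∈ S, 0 < t ∧ t < T ∧ t < b := by
  have h1 : 0 < min T b := lt_min hT hb
  have h2 : ∀ᵐ t ∂(volume.restrict (Ioo 0 (min T b))), t ∈ S :=
    ae_restrict_of_ae_restrict_of_subset (Ioo_subset_Ioo_right (min_le_left _ _)) hS
  have : (ae (volume.restrict (Ioo 0 (min T b)))).NeBot := by
    rw [ae_neBot]
    intro h
    rw [Measure.restrict_eq_zero, Real.volume_Ioo] at h
    simp only [sub_zero, ENNReal.ofReal_eq_zero] at h
    linarith
  obtain ⟨t, ht, htm⟩ := (h2.and (ae_restrict_mem measurableSet_Ioo)).exists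
  exact ⟨t, ht, htm.1, htm.2.trans_le (min_le_left _ _), htm.2.trans_le (min_le_right _ _)⟩

lemma abs_intervalIntegral_le_of_ae_Ioo {g : ℝ → ℝ} {b D : ℝ}
    (hg : ∀ᵐ t ∂(volume.restrict (Ioo 0 b)), |g t| ≤ D) {s t : ℝ} (h0 : 0 < s) (hst : s ≤ t)
    (htb : t < b) : |∫ τ in s..t, g τ| ≤ D * (t - s) := by
  have := intervalIntegral.norm_integral_le_of_norm_le_const_ae (f := g) (a := s) (b := t) (C := D) (by
    filter_upwards [(ae_restrict_iff' measurableSet_Ioo).1 hg] with x hx hxm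
    rw [uIoc_of_le hst] at hxm
    exact hx ⟨by linarith [hxm.1], by linarith [hxm.2]⟩)
  rwa [abs_of_nonneg (by linarith : 0 ≤ t - s)] at this

/-- The weighted mass of a nonnegative weighted solution stays bounded as `t → 0`. -/
lemma IsVeryWeakSolution.exists_weightedMass_bound (hN : 1 ≤ N) (hσ : 0 < σ) (hσ2 : σ < 2)
    (hm : 0 < m) (hm1 : m < 1) (hT : 0 < T) (hu : IsVeryWeakSolution σ m T u)
    (hpos : ∀ᵐ t ∂(volume.restrict (Ioo 0 T)), ∀ᵐ x, 0 ≤ u t x)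
    (ha : a ∈ weightExponents N σ m) (hw : LocL1Weighted T (bracketWeight 1 a) u) :
    ∃ b M, 0 < b ∧ b ≤ T ∧ ∀ᵐ t ∂(volume.restrict (Ioo 0 b)), weightedMass 1 a u t ≤ M := by
  obtain ⟨C, hC, hinc⟩ := hu.exists_weightedMass_increment hN hσ hσ2 hT ha.1 hw
  obtain ⟨S', hS', hS'i⟩ := hinc 1 le_rfl
  simp only [Real.one_rpow, mul_one] at hS'i
  set y := weightedMass 1 a u with hy
  set K := youngConst N σ m a with hK
  have hK0 : 0 ≤ K := youngConst_nonneg N σ m a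
  set S : Set ℝ := {t | t ∈ S' ∧ 0 ≤ y t ∧ powMass σ m u t ≤ y t + K} with hSdef
  have hS : ∀ᵐ t ∂(volume.restrict (Ioo 0 T)), t ∈ S := by
    filter_upwards [hS', hpos, hw.ae_integrable] with t h1 h2 h3
    refine ⟨h1, ?_, powMass_le hm hm1 ha.2 h2 h3⟩
    refine integral_nonneg_of_ae ?_
    filter_upwards [h2] with x hx using mul_nonneg hx (bracketWeight_pos one_pos a x).le
  -- On a time interval this short C t₀ ≤ 1/2, so the supremum of y can be absorbed below, in place
  -- of Gronwall's lemma.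
  obtain ⟨t₀, ht₀S, ht₀, ht₀T, ht₀C⟩ := exists_mem_of_ae_Ioo hS
    (show 0 < 1 / (2 * (C + 1)) by positivity) hT
  have hCt : C * t₀ ≤ 1 / 2 := by
    rw [lt_div_iff₀ (by positivity)] at ht₀C
    nlinarith
  have hgint : ∀ s, 0 < s → s < t₀ → IntervalIntegrable (powMass σ m u) volume s t₀ := fun s h0 hs =>
    (intervalIntegrable_iff_integrableOn_Icc_of_le hs.le).2
      ((hu.pow_locL1.abs (rhoWeight_pos σ)).integrableOn_integral h0 hs ht₀T)
  have hSI := (ae_restrict_iff' measurableSet_Ioo).1 hS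
  refine ⟨t₀, 2 * y t₀ + K, ht₀, ht₀T.le, ?_⟩
  have hSt : ∀ᵐ t ∂(volume.restrict (Ioo 0 t₀)), t ∈ S :=
    ae_restrict_of_ae_restrict_of_subset (Ioo_subset_Ioo_right ht₀T.le) hS
  filter_upwards [hSt, ae_restrict_mem measurableSet_Ioo] with s₀ hs₀ hs₀m
  have hg0 : ∀ t, 0 ≤ powMass σ m u t := fun t => powMass_nonneg t
  set I := ∫ τ in s₀..t₀, powMass σ m u τ with hI
  set S₀ := S ∩ Ico s₀ t₀ with hS₀
  -- Absorption needs a finite supremum. Stopping at s₀ > 0 provides it; this bound depends on s₀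
  -- but only its finiteness is used.
  have hbd : BddAbove (y '' S₀) := by
    refine ⟨y t₀ + C * I, ?_⟩
    rintro _ ⟨s, ⟨hsS, hs1, hs2⟩, rfl⟩
    have h1 := hS'i s hsS.1 t₀ ht₀S.1 (by linarith [hs₀m.1]) hs2 ht₀T
    have h2 : ∫ τ in s..t₀, powMass σ m u τ ≤ I :=
      intervalIntegral.integral_mono_interval hs1 hs2.le le_rfl
        (Eventually.of_forall hg0) (hgint s₀ hs₀m.1 hs₀m.2)
    have h3 := mul_le_mul_of_nonneg_left h2 hC
    linarith [(abs_le.1 h1).1]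
  set M := sSup (y '' S₀) with hM
  have hs₀mem : s₀ ∈ S₀ := ⟨hs₀, le_rfl, hs₀m.2⟩
  have hle : ∀ s ∈ S₀, y s ≤ M := fun s hs => le_csSup hbd (mem_image_of_mem _ hs)
  have hM0 : 0 ≤ M := hs₀.2.1.trans (hle s₀ hs₀mem)
  -- With C t₀ ≤ 1/2 this becomes M ≤ 2y(t₀) + K, which no longer involves s₀.
  have hMle : M ≤ y t₀ + C * t₀ * (M + K) := by
    refine csSup_le ⟨_, mem_image_of_mem _ hs₀mem⟩ ?_
    rintro _ ⟨s, ⟨hsS, hs1, hs2⟩, rfl⟩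
    have hs0 : 0 < s := by linarith [hs₀m.1]
    have h1 := hS'i s hsS.1 t₀ ht₀S.1 hs0 hs2 ht₀T
    have h2 : ∫ τ in s..t₀, powMass σ m u τ ≤ (M + K) * (t₀ - s) := by
      have := intervalIntegral.norm_integral_le_of_norm_le_const_ae
        (f := powMass σ m u) (a := s) (b := t₀) (C := M + K) (by
          have hne : ∀ᵐ x : ℝ, x ≠ t₀ := by simp [ae_iff]
          filter_upwards [hSI, hne] with x hx hxne hxm
          rw [uIoc_of_le hs2.le] at hxm
          have hxS := hx ⟨by linarith [hxm.1], by linarith [hxm.2]⟩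
          rw [Real.norm_of_nonneg (hg0 x)]
          have := hle x ⟨hxS, by linarith [hxm.1], lt_of_le_of_ne hxm.2 hxne⟩
          linarith [hxS.2.2])
      rw [abs_of_nonneg (by linarith : 0 ≤ t₀ - s)] at this
      exact (le_abs_self _).trans this
    have h3 : (M + K) * (t₀ - s) ≤ (M + K) * t₀ := by
      gcongr; linarith
    have h4 := mul_le_mul_of_nonneg_left (h2.trans h3) hC
    linarith [(abs_le.1 h1).1]
  have := hle s₀ hs₀mem
  nlinarith [mul_le_mul_of_nonneg_right hCt (add_nonneg hM0 hK0)]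

/-- Uniform control near `t = 0`: bounds on the moments of `u`, and tightness. -/
lemma IsVeryWeakSolution.exists_uniform_control (hN : 1 ≤ N) (hσ : 0 < σ) (hσ2 : σ < 2)
    (hm : 0 < m) (hm1 : m < 1) (hT : 0 < T) (hu : IsVeryWeakSolution σ m T u)
    (hpos : ∀ᵐ t ∂(volume.restrict (Ioo 0 T)), ∀ᵐ x, 0 ≤ u t x)
    (ha : a ∈ weightExponents N σ m) (hw : LocL1Weighted T (bracketWeight 1 a) u) :
    ∃ b M D, 0 < b ∧ b ≤ T ∧ (∀ᵐ t ∂(volume.restrict (Ioo 0 b)), weightedMass 1 a u t ≤ M) ∧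
      (∀ᵐ t ∂(volume.restrict (Ioo 0 b)), |powMass σ m u t| ≤ D) ∧
      ∀ ε > 0, ∃ R, 1 ≤ R ∧ ∀ᵐ t ∂(volume.restrict (Ioo 0 b)), weightedMass R a u t ≤ ε := by
  have ha0 : 0 ≤ a := (Nat.cast_nonneg N).trans ha.1.le
  obtain ⟨b, M, hb, hbT, hM⟩ :=
    hu.exists_weightedMass_bound hN hσ hσ2 hm hm1 hT hpos ha hw
  have hres : ∀ {p : ℝ → Prop} {b' : ℝ}, b' ≤ b → (∀ᵐ t ∂(volume.restrict (Ioo 0 b)), p t) →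
      ∀ᵐ t ∂(volume.restrict (Ioo 0 b')), p t := fun hb' h =>
    ae_restrict_of_ae_restrict_of_subset (Ioo_subset_Ioo_right hb') h
  have hresT : ∀ {p : ℝ → Prop}, (∀ᵐ t ∂(volume.restrict (Ioo 0 T)), p t) →
      ∀ᵐ t ∂(volume.restrict (Ioo 0 b)), p t := fun h =>
    ae_restrict_of_ae_restrict_of_subset (Ioo_subset_Ioo_right hbT) h
  set D := M + youngConst N σ m a with hD
  have hDb : ∀ᵐ t ∂(volume.restrict (Ioo 0 b)), |powMass σ m u t| ≤ D := by
    filter_upwards [hM, hresT hpos, hresT hw.ae_integrable] with t h1 h2 h3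
    rw [abs_of_nonneg (powMass_nonneg t)]
    linarith [powMass_le hm hm1 ha.2 h2 h3]
  obtain ⟨C, hC, hinc⟩ := hu.exists_weightedMass_increment hN hσ hσ2 hT ha.1 hw
  -- Restricting to the radii R = n + 1 keeps the exceptional set of times null.
  choose S hS hSi using fun n : ℕ => hinc ((n : ℝ) + 1) (by linarith [(Nat.cast_nonneg n : (0:ℝ) ≤ n)])
  have hall : ∀ᵐ t ∂(volume.restrict (Ioo 0 b)), t ∈ {t | (∀ n, t ∈ S n) ∧
      Integrable fun x => u t x * bracketWeight 1 a x} := by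
    filter_upwards [hresT (ae_all_iff.2 hS), hresT hw.ae_integrable] with t h1 h2 using ⟨h1, h2⟩
  obtain ⟨t₁, ⟨ht₁S, ht₁i⟩, ht₁, ht₁b, -⟩ := exists_mem_of_ae_Ioo hall one_pos hb
  have hD0 : 0 ≤ D := by
    obtain ⟨t, ht, -⟩ := exists_mem_of_ae_Ioo hDb one_pos hb
    exact (abs_nonneg _).trans ht
  refine ⟨t₁, M, D, ht₁, ht₁b.le.trans hbT, hres ht₁b.le hM, hres ht₁b.le hDb, fun ε hε => ?_⟩
  have hnat : Tendsto (fun n : ℕ => (n : ℝ) + 1) atTop atTop :=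
    tendsto_atTop_add_const_right _ _ tendsto_natCast_atTop_atTop
  have hpow : ∀ p : ℝ, 0 < p → Tendsto (fun n : ℕ => ((n : ℝ) + 1) ^ (-p)) atTop (𝓝 0) :=
    fun p hp => (tendsto_rpow_neg_atTop hp).comp hnat
  have ha1 : 0 < a := (Nat.cast_nonneg N).trans_lt ha.1
  -- At the fixed time t₁ the mass vanishes by dominated convergence. The increment between t and t₁
  -- vanishes, uniformly in t, because a > N.
  have lim1 : Tendsto (fun n : ℕ => weightedMass ((n : ℝ) + 1) a u t₁) atTop (𝓝 0) := by
    have : ∫ x : 𝔼, u t₁ x * 0 = 0 := by simp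
    rw [← this]
    refine tendsto_integral_filter_of_dominated_convergence
      (fun x => ‖u t₁ x * bracketWeight 1 a x‖) (Eventually.of_forall fun n => ?_)
      (Eventually.of_forall fun n => Eventually.of_forall fun x => ?_) ht₁i.norm
      (Eventually.of_forall fun x => ?_)
    · exact (integrable_mul_bracketWeight (by linarith [(Nat.cast_nonneg n : (0 : ℝ) ≤ n)]) ha0
        ht₁i).aestronglyMeasurable
    · rw [norm_mul, norm_mul, Real.norm_of_nonneg (bracketWeight_pos (by positivity) a x).le,
        Real.norm_of_nonneg (bracketWeight_pos one_pos a x).le]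
      gcongr
      exact bracketWeight_le_one_bracketWeight (by linarith [(Nat.cast_nonneg n : (0 : ℝ) ≤ n)]) ha0 x
    · refine Tendsto.const_mul _ ?_
      refine squeeze_zero (fun n => (bracketWeight_pos (by positivity) a x).le)
        (fun n => bracketWeight_le_rpow (by positivity) ha0 x) (hpow a ha1)
  have lim2 : Tendsto (fun n : ℕ => C * ((n : ℝ) + 1) ^ ((N : ℝ) - a) * (D * t₁)) atTop (𝓝 0) := by
    have := ((hpow (a - N) (by linarith [ha.1])).const_mul C).mul_const (D * t₁)
    simpa using this
  have lim := lim1.add lim2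
  rw [add_zero] at lim
  obtain ⟨n, hn⟩ := (lim.eventually (eventually_lt_nhds hε)).exists
  refine ⟨(n : ℝ) + 1, by linarith [(Nat.cast_nonneg n : (0 : ℝ) ≤ n)], ?_⟩
  filter_upwards [hres ht₁b.le (hresT (hS n)), ae_restrict_mem measurableSet_Ioo] with t ht htm
  have h1 := hSi n t ht t₁ (ht₁S n) htm.1 htm.2 (ht₁b.trans_le hbT)
  have h2 := abs_intervalIntegral_le_of_ae_Ioo hDb htm.1 htm.2.le ht₁b
  have h3 : ∫ τ in t..t₁, powMass σ m u τ ≤ D * t₁ :=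
    (le_abs_self _).trans (h2.trans (by gcongr; linarith [htm.1]))
  have h4 : C * ((n : ℝ) + 1) ^ ((N : ℝ) - a) * ∫ τ in t..t₁, powMass σ m u τ ≤
      C * ((n : ℝ) + 1) ^ ((N : ℝ) - a) * (D * t₁) := by gcongr
  linarith [(abs_le.1 h1).1]

end

/-! ### Comparison of the weights and essential limits at zero. -/

section

variable {σ m T a R : ℝ} {u : ℝ → EuclideanSpace ℝ (Fin N) → ℝ}

section Theta

lemma theta_pos (a : ℝ) (x : 𝔼) : 0 < theta a x := by
  unfold theta; positivity

lemma continuous_theta (a : ℝ) : Continuous (theta (N := N) a) := by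
  unfold theta
  refine continuous_const.div (Continuous.rpow_const (by fun_prop) fun x => Or.inl ?_) fun x => ?_
  · positivity
  · positivity

lemma bracketWeight_one_eq (a : ℝ) (x : 𝔼) :
    bracketWeight 1 a x = 1 / ((1 ^ 2 + ‖x‖ ^ 2) ^ 4) ^ (a / 8) := by
  unfold bracketWeight
  rw [← Real.rpow_natCast _ 4, ← Real.rpow_mul (by positivity), Real.rpow_neg (by positivity), one_div]
  congr 2; push_cast; ring

/-- With s = |x|² - 1 ≥ 0 one has (s + 2)⁴ ≤ 4(s² + 4)² ≤ 8s⁴ + 128, whence 128. Together with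
`bracketWeight_one_le` this lets the smooth weight replace ϑ_a. -/
lemma theta_le (ha : 0 ≤ a) (x : 𝔼) : theta a x ≤ 128 ^ (a / 8) * bracketWeight 1 a x := by
  rw [bracketWeight_one_eq, theta, mul_one_div, div_le_div_iff₀ (by positivity) (by positivity),
    one_mul, ← Real.mul_rpow (by norm_num) (by positivity)]
  refine Real.rpow_le_rpow (by positivity) ?_ (by positivity)
  set q := ‖x‖ ^ 2
  have hq : 0 ≤ q := by positivity
  rcases le_total q 1 with h | h
  · rw [max_eq_right (by linarith)]
    have : (1 ^ 2 + q) ^ 4 ≤ 2 ^ 4 := by gcongr; linarith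
    norm_num at this ⊢
    linarith
  · rw [max_eq_left (by linarith)]
    obtain ⟨s, hs⟩ : ∃ s, s = q - 1 := ⟨_, rfl⟩
    rw [← hs, show (1 : ℝ) ^ 2 + q = s + 2 by rw [hs]; ring]
    have h1 : (s + 2) ^ 2 ≤ 2 * (s ^ 2 + 4) := by nlinarith [sq_nonneg (s - 2)]
    have h2 : ((s + 2) ^ 2) ^ 2 ≤ (2 * (s ^ 2 + 4)) ^ 2 := by gcongr
    nlinarith [sq_nonneg (s ^ 2 - 4)]

lemma bracketWeight_one_le (ha : 0 ≤ a) (x : 𝔼) :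
    bracketWeight 1 a x ≤ 2 ^ (a / 8) * theta a x := by
  rw [bracketWeight_one_eq, theta, mul_one_div, div_le_div_iff₀ (by positivity) (by positivity),
    one_mul, ← Real.mul_rpow (by norm_num) (by positivity)]
  refine Real.rpow_le_rpow (by positivity) ?_ (by positivity)
  have h1 : max (‖x‖ ^ 2 - 1) 0 ≤ 1 ^ 2 + ‖x‖ ^ 2 :=
    max_le (by linarith) (by positivity)
  have h2 : max (‖x‖ ^ 2 - 1) 0 ^ 4 ≤ (1 ^ 2 + ‖x‖ ^ 2) ^ 4 := by gcongr
  have h3 : (1 : ℝ) ≤ (1 ^ 2 + ‖x‖ ^ 2) ^ 4 := one_le_pow₀ (by nlinarith [sq_nonneg ‖x‖])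
  linarith

lemma abs_bracketWeight_one_le (ha : 0 ≤ a) (x : 𝔼) :
    |bracketWeight 1 a x| ≤ 2 ^ (a / 8) * theta a x := by
  rw [abs_of_pos (bracketWeight_pos one_pos a x)]; exact bracketWeight_one_le ha x

lemma LocL1Weighted.bracketWeight_of_theta (ha : 0 ≤ a) (h : LocL1Weighted T (theta a) u) :
    LocL1Weighted T (bracketWeight 1 a) u :=
  h.of_le_mul (theta_pos a) (continuous_theta a).measurable
    (continuous_bracketWeight one_pos a).measurable (abs_bracketWeight_one_le ha)

end Theta

section EssentialLimits

lemma eventually_essZeroRight {b : ℝ} (hb : 0 < b) {p : ℝ → Prop}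
    (h : ∀ᵐ t ∂(volume.restrict (Ioo 0 b)), p t) : ∀ᶠ t in essZeroRight, p t := by
  have h1 : ∀ᶠ t in essZeroRight, t ∈ Ioo 0 b := mem_inf_of_left (Ioo_mem_nhdsGT hb)
  have h2 : ∀ᶠ t in essZeroRight, t ∈ Ioo 0 b → p t :=
    mem_inf_of_right ((ae_restrict_iff' measurableSet_Ioo).1 h)
  filter_upwards [h1, h2] with t ht1 ht2 using ht2 ht1

/-- A set of full measure meets every interval (0, b). Hence essential limits are unique and inherit
inequalities. -/
instance neBot_essZeroRight : essZeroRight.NeBot := by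
  unfold essZeroRight
  rw [inf_neBot_iff]
  intro s hs s' hs'
  obtain ⟨b, hb, hbs⟩ := mem_nhdsGT_iff_exists_Ioo_subset.1 hs
  have h2 : ∀ᵐ t ∂(volume.restrict (Ioo 0 (b : ℝ))), t ∈ s' := ae_restrict_of_ae hs'
  obtain ⟨t, ht, h0, htb, -⟩ := exists_mem_of_ae_Ioo h2 one_pos hb
  exact ⟨t, hbs ⟨h0, htb⟩, ht⟩

/-- An essential limit at `0⁺` of a function continuous on `(0,T)` is a limit. -/
lemma tendsto_nhdsGT_of_essZeroRight (hT : 0 < T) {F : ℝ → ℝ} (hF : ContinuousOn F (Ioo 0 T))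
    {L : ℝ} (h : Tendsto F essZeroRight (𝓝 L)) : Tendsto F (𝓝[>] 0) (𝓝 L) := by
  rw [Metric.tendsto_nhds] at h ⊢
  intro ε hε
  obtain ⟨s, hs, s', hs', hss⟩ := mem_inf_iff_superset.1 (h (ε / 2) (half_pos hε))
  obtain ⟨b, hb, hbs⟩ := mem_nhdsGT_iff_exists_Ioo_subset.1 hs
  have hb' : (0 : ℝ) < min b T := lt_min hb hT
  filter_upwards [Ioo_mem_nhdsGT hb'] with t ht
  have hc : ContinuousAt F t :=
    hF.continuousAt (Ioo_mem_nhds ht.1 (ht.2.trans_le (min_le_right _ _)))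
  have h1 : {r | dist (F r) (F t) < ε / 2} ∩ Ioo 0 (min b T) ∈ 𝓝 t :=
    inter_mem (Metric.tendsto_nhds.1 hc (ε / 2) (half_pos hε)) (Ioo_mem_nhds ht.1 ht.2)
  -- Every t is approached by good times r, at which F is already close to L; continuity at t
  -- transfers this to F t.
  have hd : Dense s' := Measure.dense_of_ae (μ := (volume : Measure ℝ)) hs'
  obtain ⟨r, hr', hr⟩ := hd.inter_nhds_nonempty h1
  have h2 : dist (F r) L < ε / 2 :=
    hss ⟨hbs ⟨hr.2.1, hr.2.2.trans_le (min_le_left _ _)⟩, hr'⟩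
  have h3 : dist (F t) (F r) < ε / 2 := by rw [dist_comm]; exact hr.1
  linarith [dist_triangle (F t) (F r) L]

end EssentialLimits

/-! ### Limits of the moments and existence of the trace. -/

/-- Approximate φ/w uniformly by a smooth g and multiply back by a truncation of w that equals w on
the support of φ. The error is measured against w because the mass bound on u is. -/
lemma exists_smooth_approx (a : ℝ) {φ : 𝔼 → ℝ} (hφ : Continuous φ) (hc : HasCompactSupport φ)
    {ε : ℝ} (hε : 0 < ε) : ∃ ψ : 𝔼 → ℝ, ContDiff ℝ ∞ ψ ∧ HasCompactSupport ψ ∧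
      ∀ x, |ψ x - φ x| ≤ ε * bracketWeight 1 a x := by
  have hw := fun x : 𝔼 => bracketWeight_pos one_pos a x
  set f : 𝔼 → ℝ := fun x => φ x * (bracketWeight 1 a x)⁻¹ with hf
  have hfc : Continuous f :=
    hφ.mul ((continuous_bracketWeight one_pos a).inv₀ fun x => (hw x).ne')
  have hfs : HasCompactSupport f := hc.mul_right
  obtain ⟨g, hg, hgf⟩ :=
    (hfs.uniformContinuous_of_continuous hfc).exists_contDiff_dist_le hε
  obtain ⟨L, hL⟩ := hc.isCompact.isBounded.subset_closedBall (0 : 𝔼)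
  set k := 1 ^ 2 + L ^ 2 with hk
  have hk0 : 0 < k := by positivity
  refine ⟨fun x => cutWeight 1 a k x * g x, (contDiff_cutWeight one_pos a k).mul hg,
    (hasCompactSupport_cutWeight 1 a hk0).mul_right, fun x => ?_⟩
  have e : φ x = cutWeight 1 a k x * f x := by
    rw [cutWeight_eq, hf]
    by_cases hx : φ x = 0
    · simp [hx]
    · have h1 := hL (subset_tsupport _ hx)
      rw [mem_closedBall_zero_iff] at h1
      rw [cutoff_eq_one]
      · have := (hw x).ne'
        field_simp
      · rw [div_le_one hk0, hk]
        gcongr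
  rw [e, ← mul_sub, abs_mul, abs_of_nonneg (cutWeight_nonneg one_pos a k x), mul_comm]
  have h1 := (hgf x).le
  rw [Real.dist_eq] at h1
  exact mul_le_mul h1 (cutWeight_le one_pos a k x) (cutWeight_nonneg one_pos a k x) hε.le

lemma abs_integral_mul_sub_le {f φ ψ w : 𝔼 → ℝ} {ε : ℝ} (hpos : ∀ᵐ x, 0 ≤ f x)
    (hφ : Integrable fun x => f x * φ x) (hψ : Integrable fun x => f x * ψ x)
    (hw : Integrable fun x => f x * w x) (h : ∀ x, |ψ x - φ x| ≤ ε * w x) :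
    |(∫ x, f x * ψ x) - ∫ x, f x * φ x| ≤ ε * ∫ x, f x * w x := by
  rw [← integral_sub hψ hφ, ← integral_const_mul, ← Real.norm_eq_abs]
  refine norm_integral_le_of_norm_le (hw.const_mul ε) ?_
  filter_upwards [hpos] with x hx
  rw [← mul_sub, norm_mul, Real.norm_of_nonneg hx, Real.norm_eq_abs]
  nlinarith [h x, mul_le_mul_of_nonneg_left (h x) hx]

lemma exists_abs_le_bracketWeight (a : ℝ) {φ : 𝔼 → ℝ} (hφ : Continuous φ)
    (hc : HasCompactSupport φ) : ∃ C, ∀ x, |φ x| ≤ C * bracketWeight 1 a x := by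
  have hw := fun x : 𝔼 => bracketWeight_pos one_pos a x
  obtain ⟨C, hC⟩ := (hc.mul_right (f' := fun x => (bracketWeight 1 a x)⁻¹)).exists_bound_of_continuous
    (by exact hφ.mul ((continuous_bracketWeight one_pos a).inv₀ fun x => (hw x).ne'))
  refine ⟨C, fun x => ?_⟩
  have := hC x
  rwa [Pi.mul_apply, norm_mul, norm_inv, Real.norm_of_nonneg (hw x).le, ← div_eq_mul_inv,
    div_le_iff₀ (hw x)] at this

lemma integrable_mul_of_compactSupport {f φ : 𝔼 → ℝ} (hf : Integrable fun x => f x * bracketWeight 1 a x)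
    (hφ : Continuous φ) (hc : HasCompactSupport φ) : Integrable fun x => f x * φ x := by
  obtain ⟨C, hC⟩ := exists_abs_le_bracketWeight a hφ hc
  exact integrable_mul_of_abs_le hf (bracketWeight_pos one_pos a)
    (continuous_bracketWeight one_pos a).measurable hφ.measurable hC

lemma locallyIntegrable_of_mul_bracketWeight {f : 𝔼 → ℝ}
    (hf : Integrable fun x => f x * bracketWeight 1 a x) : LocallyIntegrable f := by
  have h1 := (continuous_bracketWeight (N := N) one_pos a).inv₀
    fun x => (bracketWeight_pos one_pos a x).ne'
  rw [locallyIntegrable_iff]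
  intro K hK
  refine ((hf.integrableOn (s := K)).mul_continuousOn h1.continuousOn hK).congr
    (Eventually.of_forall fun x => ?_)
  have := (bracketWeight_pos one_pos a x).ne'
  simp only [Pi.inv_apply]
  field_simp

lemma ae_ae_nonneg (hpos : ∀ᵐ p ∂((volume : Measure (ℝ × EuclideanSpace ℝ (Fin N))).restrict
      (Ioo 0 T ×ˢ univ)), 0 ≤ u p.1 p.2) :
    ∀ᵐ t ∂(volume.restrict (Ioo 0 T)), ∀ᵐ x, 0 ≤ u t x := by
  rw [Measure.volume_eq_prod, ← Measure.prod_restrict, Measure.restrict_univ] at hpos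
  exact Measure.ae_ae_of_ae_prod hpos

/-- Bounded `powMass` makes the continuous representative of the moment Lipschitz near 0, hence
Cauchy as t → 0. -/
lemma exists_tendsto_moment_smooth
    (hN : 1 ≤ N) (hσ : 0 < σ) (hσ2 : σ < 2)
    (hm : 0 < m) (hm1 : m < 1) (hT : 0 < T) (hu : IsVeryWeakSolution σ m T u)
    (hpos : ∀ᵐ t ∂(volume.restrict (Ioo 0 T)), ∀ᵐ x, 0 ≤ u t x)
    (ha : a ∈ weightExponents N σ m) (hw : LocL1Weighted T (bracketWeight 1 a) u)
    {ψ : 𝔼 → ℝ} (hψ : ContDiff ℝ ∞ ψ) (hψc : HasCompactSupport ψ) :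
    ∃ L, Tendsto (fun t => ∫ x, u t x * ψ x) essZeroRight (𝓝 L) := by
  have ha0 : 0 ≤ a := (Nat.cast_nonneg N).trans ha.1.le
  obtain ⟨b, M, D, hb, hbT, -, hD, -⟩ :=
    hu.exists_uniform_control hN hσ hσ2 hm hm1 hT hpos ha hw
  obtain ⟨A, hA⟩ := exists_bracketDecay_of_contDiff hψ hψc ha0
  obtain ⟨P, hP, hPi⟩ := hu.exists_moment_repr hN hσ hσ2 hT le_rfl ha.1 hA hψ hψc
  set C := fracLapBound N σ a * A * (1 : ℝ) ^ ((N : ℝ) - a) with hC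
  have hC0 : 0 ≤ C := by
    have := hA.nonneg one_pos
    have := fracLapBound_nonneg N σ a
    positivity
  have hle : ∀ s t, 0 < s → s ≤ t → t < b → |P t - P s| ≤ C * (D * (t - s)) := by
    intro s t h0 hst htb
    rcases hst.eq_or_lt with rfl | hst
    · simp
    · refine (hPi s t h0 hst (by linarith)).trans ?_
      gcongr
      exact (le_abs_self _).trans (abs_intervalIntegral_le_of_ae_Ioo hD h0 hst.le htb)
  have hlip : LipschitzOnWith (Real.toNNReal (C * D)) P (Ioo 0 b) := by
    refine LipschitzOnWith.of_dist_le' fun s hs t ht => ?_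
    rw [Real.dist_eq, Real.dist_eq]
    rcases le_total s t with hst | hst
    · rw [abs_sub_comm, abs_sub_comm s t, abs_of_nonneg (by linarith : 0 ≤ t - s)]
      linarith [hle s t hs.1 hst ht.2]
    · rw [abs_of_nonneg (by linarith : 0 ≤ s - t)]
      linarith [hle t s ht.1 hst hs.2]
  have hcau : Cauchy (map P (𝓝[>] (0 : ℝ))) := by
    refine Cauchy.map_of_le (cauchy_nhds.mono nhdsWithin_le_nhds) hlip.uniformContinuousOn ?_
    rw [le_principal_iff]; exact Ioo_mem_nhdsGT hb
  obtain ⟨L, hL⟩ := cauchy_map_iff_exists_tendsto.1 hcau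
  refine ⟨L, (hL.mono_left inf_le_left).congr' ?_⟩
  filter_upwards [eventually_essZeroRight hT hP] with t ht using ht.symm

lemma exists_tendsto_moment
    (hN : 1 ≤ N) (hσ : 0 < σ) (hσ2 : σ < 2)
    (hm : 0 < m) (hm1 : m < 1) (hT : 0 < T) (hu : IsVeryWeakSolution σ m T u)
    (hpos : ∀ᵐ t ∂(volume.restrict (Ioo 0 T)), ∀ᵐ x, 0 ≤ u t x)
    (ha : a ∈ weightExponents N σ m) (hw : LocL1Weighted T (bracketWeight 1 a) u)
    {φ : 𝔼 → ℝ} (hφ : Continuous φ) (hc : HasCompactSupport φ) :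
    ∃ L, Tendsto (fun t => ∫ x, u t x * φ x) essZeroRight (𝓝 L) := by
  obtain ⟨b, M, D, hb, hbT, hM, -, -⟩ :=
    hu.exists_uniform_control hN hσ hσ2 hm hm1 hT hpos ha hw
  refine cauchy_map_iff_exists_tendsto.1 (Metric.cauchy_iff.2 ⟨inferInstance, fun ε hε => ?_⟩)
  -- The approximation then costs at most ε/4 at almost every small time; |M| + 1 avoids dividing by
  -- zero.
  set δ := ε / (4 * (|M| + 1)) with hδ
  have hδ0 : 0 < δ := by positivity
  obtain ⟨ψ, hψ, hψc, hψφ⟩ := exists_smooth_approx a hφ hc hδ0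
  obtain ⟨L, hL⟩ := exists_tendsto_moment_smooth hN hσ hσ2 hm hm1 hT hu hpos ha hw hψ hψc
  have hev : ∀ᶠ t in essZeroRight, |(∫ x, u t x * φ x) - L| < ε / 2 := by
    filter_upwards [Metric.tendsto_nhds.1 hL (ε / 4) (by positivity), eventually_essZeroRight hb hM,
      eventually_essZeroRight hT hpos, eventually_essZeroRight hT hw.ae_integrable] with t h1 h2 h3 h4
    have h5 := abs_integral_mul_sub_le h3 (integrable_mul_of_compactSupport h4 hφ hc)
      (integrable_mul_of_compactSupport h4 hψ.continuous hψc) h4 hψφ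
    have h6 : δ * ∫ x, u t x * bracketWeight 1 a x ≤ ε / 4 := by
      calc _ ≤ δ * (|M| + 1) := by gcongr; exact h2.trans (by linarith [le_abs_self M])
        _ = ε / 4 := by rw [hδ]; field_simp
    rw [Real.dist_eq] at h1
    rw [abs_lt] at h1 ⊢
    have h7 := abs_le.1 (h5.trans h6)
    constructor <;> linarith [h7.1, h7.2, h1.1, h1.2]
  refine ⟨_, image_mem_map hev, ?_⟩
  rintro _ ⟨s, hs, rfl⟩ _ ⟨t, ht, rfl⟩
  have hs' : |(∫ x, u s x * φ x) - L| < ε / 2 := hs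
  have ht' : |(∫ x, u t x * φ x) - L| < ε / 2 := ht
  rw [Real.dist_eq]
  rw [abs_lt] at hs' ht' ⊢
  constructor <;> linarith [hs'.1, hs'.2, ht'.1, ht'.2]

/-- Existence of the initial trace. -/
theorem exists_initialTrace
    (hN : 1 ≤ N) (hσ : 0 < σ) (hσ2 : σ < 2)
    (hm : 0 < m) (hm1 : m < 1) (hT : 0 < T) (hu : IsVeryWeakSolution σ m T u)
    (hpos : ∀ᵐ t ∂(volume.restrict (Ioo 0 T)), ∀ᵐ x, 0 ≤ u t x)
    (ha : a ∈ weightExponents N σ m) (hw : LocL1Weighted T (bracketWeight 1 a) u) :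
    ∃ μ : Measure 𝔼, IsRadon μ ∧ VagueLimit essZeroRight u μ := by
  choose L hL using fun f : CompactlySupportedContinuousMap 𝔼 ℝ =>
    exists_tendsto_moment hN hσ hσ2 hm hm1 hT hu hpos ha hw f.continuous f.hasCompactSupport
  have hint := eventually_essZeroRight hT hw.ae_integrable
  -- Linearity of the limit functional follows from uniqueness of essential limits.
  let Λ₀ : CompactlySupportedContinuousMap 𝔼 ℝ →ₗ[ℝ] ℝ :=
    { toFun := L
      map_add' := fun f g => by
        refine tendsto_nhds_unique (hL (f + g)) (((hL f).add (hL g)).congr' ?_)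
        filter_upwards [hint] with t ht
        rw [← integral_add (integrable_mul_of_compactSupport ht f.continuous f.hasCompactSupport)
          (integrable_mul_of_compactSupport ht g.continuous g.hasCompactSupport)]
        simp [mul_add]
      map_smul' := fun c f => by
        refine tendsto_nhds_unique (hL (c • f)) (((hL f).const_mul c).congr fun t => ?_)
        rw [← integral_const_mul]
        congr 1; ext x
        simp [mul_left_comm] }
  let Λ : CompactlySupportedContinuousMap 𝔼 ℝ →ₚ[ℝ] ℝ := PositiveLinearMap.mk₀ Λ₀ fun f hf => by
    refine ge_of_tendsto (hL f) ?_
    filter_upwards [eventually_essZeroRight hT hpos] with t ht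
    refine integral_nonneg_of_ae ?_
    filter_upwards [ht] with x hx using mul_nonneg hx (hf x)
  refine ⟨RealRMK.rieszMeasure Λ, ⟨inferInstance, inferInstance⟩, ?_, fun φ hφ hc => ?_⟩
  · filter_upwards [hint] with t ht using locallyIntegrable_of_mul_bracketWeight ht
  · have h1 := RealRMK.integral_rieszMeasure Λ ⟨⟨φ, hφ⟩, hc⟩
    have h2 := hL ⟨⟨φ, hφ⟩, hc⟩
    have h3 : ∫ x, φ x ∂(RealRMK.rieszMeasure Λ) = L ⟨⟨φ, hφ⟩, hc⟩ := h1
    rw [h3]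
    exact h2

end

/-! ### Weighted masses of the trace, uniqueness, and the continuous case. -/

section

variable {σ m T a R : ℝ} {u : ℝ → EuclideanSpace ℝ (Fin N) → ℝ}

/-- The weight `ϑ_a` multiplied by the cutoff `χ((1 + |x|²)/k)`. -/
def cutTheta (a k : ℝ) (x : 𝔼) : ℝ := theta a x * cutoff ((1 + ‖x‖ ^ 2) / k)

lemma cutTheta_nonneg (a k : ℝ) (x : 𝔼) : 0 ≤ cutTheta a k x :=
  mul_nonneg (theta_pos a x).le (cutoff_nonneg _)

lemma cutTheta_le (a k : ℝ) (x : 𝔼) : cutTheta a k x ≤ theta a x :=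
  mul_le_of_le_one_right (theta_pos a x).le (cutoff_le_one _)

lemma continuous_cutTheta (a k : ℝ) : Continuous (cutTheta (N := N) a k) :=
  (continuous_theta a).mul ((contDiff_cutoff (n := 1)).continuous.comp (by fun_prop))

lemma hasCompactSupport_cutTheta (a : ℝ) {k : ℝ} (hk : 0 < k) :
    HasCompactSupport (cutTheta (N := N) a k) := by
  refine HasCompactSupport.intro (isCompact_closedBall (0 : 𝔼) √(2 * k)) fun x hx => ?_
  rw [mem_closedBall_zero_iff, not_le] at hx
  rw [cutTheta, cutoff_eq_zero, mul_zero]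
  rw [le_div_iff₀ hk]
  have := Real.lt_sq_of_sqrt_lt hx
  linarith

lemma tendsto_cutTheta (a : ℝ) (x : 𝔼) :
    Tendsto (fun k : ℕ => cutTheta a ((k : ℝ) + 1) x) atTop (𝓝 (theta a x)) := by
  refine tendsto_const_nhds.congr' ?_
  obtain ⟨n, hn⟩ := exists_nat_gt (1 + ‖x‖ ^ 2)
  filter_upwards [eventually_ge_atTop n] with k hk
  have hk' : (n : ℝ) ≤ k := by exact_mod_cast hk
  rw [cutTheta, cutoff_eq_one, mul_one]
  rw [div_le_one (by positivity)]
  linarith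

/-- The difference lives where 1 + |x|² > k ≥ 1 + R². There R < |x|, so R² + |x|² ≤ 2(1 + |x|²) and
w_1 ≤ 2^{a/2} w_R: the tail of ϑ_a is paid for by the tight mass. -/
lemma abs_theta_sub_cutTheta_le (hR : 1 ≤ R) (ha : 0 ≤ a) {k : ℝ} (hk : 1 + R ^ 2 ≤ k) (x : 𝔼) :
    |theta a x - cutTheta a k x| ≤ 128 ^ (a / 8) * 2 ^ (a / 2) * bracketWeight R a x := by
  have hR0 : 0 < R := by linarith
  have hw := bracketWeight_pos hR0 a x
  have hk0 : 0 < k := by nlinarith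
  by_cases hx : 1 + ‖x‖ ^ 2 ≤ k
  · rw [cutTheta, cutoff_eq_one ((div_le_one hk0).2 hx), mul_one, sub_self, abs_zero]
    positivity
  · push Not at hx
    rw [abs_of_nonneg (by linarith [cutTheta_le a k x])]
    have h1 : bracketWeight 1 a x ≤ 2 ^ (a / 2) * bracketWeight R a x := by
      unfold bracketWeight
      rw [Real.rpow_neg (by positivity), Real.rpow_neg (by positivity), ← div_eq_mul_inv,
        ← one_div, div_le_div_iff₀ (by positivity) (by positivity), one_mul,
        ← Real.mul_rpow (by norm_num) (by positivity)]
      exact Real.rpow_le_rpow (by positivity) (by nlinarith) (by positivity)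
    calc theta a x - cutTheta a k x ≤ theta a x := by linarith [cutTheta_nonneg a k x]
      _ ≤ 128 ^ (a / 8) * bracketWeight 1 a x := theta_le ha x
      _ ≤ 128 ^ (a / 8) * (2 ^ (a / 2) * bracketWeight R a x) := by gcongr
      _ = _ := by ring

/-- Fatou's lemma along the truncations. -/
lemma integrable_of_forall_integral_cutTheta_le {μ : Measure 𝔼} [IsLocallyFiniteMeasure μ] {B : ℝ}
    (h : ∀ k : ℕ, ∫ x, cutTheta a ((k : ℝ) + 1) x ∂μ ≤ B) : Integrable (theta a) μ := by
  have hint : ∀ k : ℕ, Integrable (cutTheta a ((k : ℝ) + 1)) μ := fun k =>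
    (continuous_cutTheta a _).integrable_of_hasCompactSupport
      (hasCompactSupport_cutTheta a (by positivity))
  refine ⟨(continuous_theta a).aestronglyMeasurable, ?_⟩
  rw [hasFiniteIntegral_iff_ofReal (Eventually.of_forall fun x => (theta_pos a x).le)]
  have h1 : ∫⁻ x, ENNReal.ofReal (theta a x) ∂μ ≤
      liminf (fun k : ℕ => ∫⁻ x, ENNReal.ofReal (cutTheta a ((k : ℝ) + 1) x) ∂μ) atTop := by
    have e : ∀ x : 𝔼, ENNReal.ofReal (theta a x) =
        liminf (fun k : ℕ => ENNReal.ofReal (cutTheta a ((k : ℝ) + 1) x)) atTop := fun x =>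
      ((ENNReal.continuous_ofReal.tendsto _).comp (tendsto_cutTheta a x)).liminf_eq.symm
    simp only [e]
    exact lintegral_liminf_le fun k =>
      ENNReal.measurable_ofReal.comp (continuous_cutTheta a _).measurable
  refine h1.trans_lt (lt_of_le_of_lt ?_ (ENNReal.ofReal_lt_top (r := B)))
  refine liminf_le_of_le (by isBoundedDefault) fun c hc => ?_
  obtain ⟨k, hk⟩ := hc.exists
  refine hk.trans ?_
  rw [← ofReal_integral_eq_lintegral_ofReal (hint k)
    (Eventually.of_forall fun x => cutTheta_nonneg a _ x)]
  exact ENNReal.ofReal_le_ofReal (h k)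

/-- Convergence of the weighted masses to the mass of the trace. -/
theorem integrable_theta_and_tendsto (hN : 1 ≤ N) (hσ : 0 < σ) (hσ2 : σ < 2) (hm : 0 < m)
    (hm1 : m < 1) (hT : 0 < T) (hu : IsVeryWeakSolution σ m T u)
    (hpos : ∀ᵐ t ∂(volume.restrict (Ioo 0 T)), ∀ᵐ x, 0 ≤ u t x)
    (ha : a ∈ weightExponents N σ m) (hw : LocL1Weighted T (theta a) u)
    {μ : Measure 𝔼} (hμ : IsRadon μ) (hv : VagueLimit essZeroRight u μ) :
    Integrable (theta a) μ ∧
      Tendsto (fun t => ∫ x, u t x * theta a x) essZeroRight (𝓝 (∫ x, theta a x ∂μ)) := by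
  have := hμ.1
  have ha0 : 0 ≤ a := (Nat.cast_nonneg N).trans ha.1.le
  have hw' := hw.bracketWeight_of_theta ha0
  obtain ⟨b, M, D, hb, hbT, hM, -, htight⟩ :=
    hu.exists_uniform_control hN hσ hσ2 hm hm1 hT hpos ha hw'
  have hcl : ∀ k : ℕ, Tendsto (fun t => ∫ x, u t x * cutTheta a ((k : ℝ) + 1) x) essZeroRight
      (𝓝 (∫ x, cutTheta a ((k : ℝ) + 1) x ∂μ)) := fun k =>
    hv.2 _ (continuous_cutTheta a _) (hasCompactSupport_cutTheta a (by positivity))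
  have hposE := eventually_essZeroRight hT hpos
  have hθi := eventually_essZeroRight hT hw.ae_integrable
  have hwi := eventually_essZeroRight hT hw'.ae_integrable
  have hint : Integrable (theta a) μ := by
    refine integrable_of_forall_integral_cutTheta_le (B := 128 ^ (a / 8) * M) fun k => ?_
    refine le_of_tendsto (hcl k) ?_
    filter_upwards [hposE, hwi, eventually_essZeroRight hb hM] with t h1 h2 h3
    calc _ ≤ ∫ x, 128 ^ (a / 8) * (u t x * bracketWeight 1 a x) := by
          refine integral_mono_ae (integrable_mul_of_compactSupport h2 (continuous_cutTheta a _)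
            (hasCompactSupport_cutTheta a (by positivity))) (h2.const_mul _) ?_
          filter_upwards [h1] with x hx
          have := (cutTheta_le a ((k : ℝ) + 1) x).trans (theta_le ha0 x)
          nlinarith [mul_le_mul_of_nonneg_left this hx]
      _ ≤ _ := by rw [integral_const_mul]; gcongr; exact h3
  refine ⟨hint, ?_⟩
  rw [Metric.tendsto_nhds]
  intro ε hε
  set B : ℝ := 128 ^ (a / 8) * 2 ^ (a / 2) with hB
  have hB0 : 0 < B := by positivity
  obtain ⟨R, hR, hRt⟩ := htight (ε / (3 * B)) (by positivity)
  have hlim : Tendsto (fun k : ℕ => ∫ x, cutTheta a ((k : ℝ) + 1) x ∂μ) atTop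
      (𝓝 (∫ x, theta a x ∂μ)) := by
    refine tendsto_integral_of_dominated_convergence _
      (fun k => (continuous_cutTheta a _).aestronglyMeasurable) hint
      (fun k => Eventually.of_forall fun x => ?_) (Eventually.of_forall fun x => tendsto_cutTheta a x)
    rw [Real.norm_of_nonneg (cutTheta_nonneg a _ x)]
    exact cutTheta_le a _ x
  have hklarge : ∀ᶠ k : ℕ in atTop, 1 + R ^ 2 ≤ (k : ℝ) + 1 := by
    have := tendsto_natCast_atTop_atTop (R := ℝ)
    filter_upwards [this.eventually_ge_atTop (R ^ 2)] with k hk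
    linarith
  -- One k serves twice: it truncates ϑ_a within ε/3 against μ, and beyond radius R, where tightness
  -- bounds the error against u(t) uniformly in t. Vague convergence supplies the remaining ε/3.
  obtain ⟨k, hk1, hk2⟩ := ((Metric.tendsto_nhds.1 hlim (ε / 3) (by positivity)).and hklarge).exists
  filter_upwards [Metric.tendsto_nhds.1 (hcl k) (ε / 3) (by positivity), hposE, hθi, hwi,
    eventually_essZeroRight hb hRt] with t h1 h2 h3 h4 h5
  have h6 := abs_integral_mul_sub_le h2 (integrable_mul_of_compactSupport h4 (continuous_cutTheta a _)
    (hasCompactSupport_cutTheta a (by positivity))) h3 (integrable_mul_bracketWeight hR ha0 h4)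
    (abs_theta_sub_cutTheta_le hR ha0 hk2)
  have h7 : B * ∫ x, u t x * bracketWeight R a x ≤ ε / 3 := by
    calc _ ≤ B * (ε / (3 * B)) := by gcongr; exact h5
      _ = ε / 3 := by field_simp
  have h8 := abs_le.1 (h6.trans h7)
  rw [Real.dist_eq, abs_lt] at h1 hk1 ⊢
  constructor <;> linarith [h8.1, h8.2, h1.1, h1.2, hk1.1, hk1.2]

lemma vagueLimit_unique {μ ν : Measure 𝔼} (hμ : IsRadon μ) (hν : IsRadon ν)
    (hvμ : VagueLimit essZeroRight u μ) (hvν : VagueLimit essZeroRight u ν) : ν = μ := by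
  have := hμ.2
  have := hν.2
  refine Measure.ext_of_integral_eq_on_compactlySupported fun f => ?_
  exact tendsto_nhds_unique (hvν.2 f f.continuous f.hasCompactSupport)
    (hvμ.2 f f.continuous f.hasCompactSupport)

lemma ContL1Weighted.continuousOn_integral {w v : 𝔼 → ℝ} (h : ContL1Weighted T w u)
    (hw : ∀ x, 0 < w x) (hwm : Measurable w) (hvm : Measurable v) {C : ℝ}
    (hC : ∀ x, |v x| ≤ C * w x) : ContinuousOn (fun t => ∫ x, u t x * v x) (Ioo 0 T) := by
  have hi : ∀ t ∈ Ioo 0 T, Integrable fun x => u t x * v x := fun t ht =>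
    integrable_mul_of_abs_le (h.1 t ht) hw hwm hvm hC
  intro t₀ ht₀
  refine ContinuousAt.continuousWithinAt ?_
  rw [ContinuousAt, tendsto_iff_norm_sub_tendsto_zero]
  have hlim := (h.2 t₀ ht₀).const_mul C
  rw [mul_zero] at hlim
  refine squeeze_zero' (Eventually.of_forall fun t => norm_nonneg _) ?_ hlim
  filter_upwards [Ioo_mem_nhds ht₀.1 ht₀.2] with t ht
  rw [← integral_sub (hi t ht) (hi t₀ ht₀), ← integral_const_mul]
  have hd : Integrable fun x => |u t x - u t₀ x| * w x := by
    refine ((h.1 t ht).sub (h.1 t₀ ht₀)).norm.congr (Eventually.of_forall fun x => ?_)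
    simp only [Pi.sub_apply, ← sub_mul, norm_mul, Real.norm_eq_abs, abs_of_pos (hw x)]
  refine norm_integral_le_of_norm_le (hd.const_mul C) (Eventually.of_forall fun x => ?_)
  rw [← sub_mul, norm_mul, Real.norm_eq_abs, Real.norm_eq_abs]
  have := mul_le_mul_of_nonneg_left (hC x) (abs_nonneg (u t x - u t₀ x))
  linarith

/-- A compactly supported φ is dominated by a multiple of ϑ_a, so its moment is continuous on (0,T)
and its essential limit is a limit. -/
lemma vagueLimit_nhdsGT_of_contL1Weighted (hT : 0 < T) (ha : 0 ≤ a)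
    (h : ContL1Weighted T (theta a) u) {μ : Measure 𝔼} (hv : VagueLimit essZeroRight u μ) :
    VagueLimit (𝓝[>] (0 : ℝ)) u μ := by
  refine ⟨?_, fun φ hφ hc => ?_⟩
  · filter_upwards [Ioo_mem_nhdsGT hT] with t ht
    exact locallyIntegrable_of_mul_bracketWeight (integrable_mul_of_abs_le (h.1 t ht) (theta_pos a)
      (continuous_theta a).measurable (continuous_bracketWeight one_pos a).measurable
      (abs_bracketWeight_one_le ha))
  · obtain ⟨C, hC⟩ := exists_abs_le_bracketWeight a hφ hc
    have hC0 : 0 ≤ C := nonneg_of_mul_nonneg_left ((abs_nonneg _).trans (hC 0))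
      (bracketWeight_pos one_pos a 0)
    refine tendsto_nhdsGT_of_essZeroRight hT (h.continuousOn_integral (theta_pos a)
      (continuous_theta a).measurable hφ.measurable (C := C * 2 ^ (a / 8)) fun x => ?_)
      (hv.2 φ hφ hc)
    rw [mul_assoc]
    exact (hC x).trans (by gcongr; exact bracketWeight_one_le ha x)

end

end FracDiffusion

end

/-! ### Assembly. -/

theorem mainTheorem6 (N : ℕ) (hN : 1 ≤ N) (σ m T : ℝ) (hσ : 0 < σ) (hσ2 : σ < 2)
    (hm : 0 < m) (hm1 : m < 1) (hT : 0 < T)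
    (u : ℝ → EuclideanSpace ℝ (Fin N) → ℝ)
    (hu : FracDiffusion.IsWeightedSolution σ m T u)
    (hpos : ∀ᵐ p ∂((volume : Measure (ℝ × EuclideanSpace ℝ (Fin N))).restrict
      (Ioo 0 T ×ˢ univ)), 0 ≤ u p.1 p.2) :
    ∃ μ : Measure (EuclideanSpace ℝ (Fin N)),
      (FracDiffusion.IsRadon μ ∧ FracDiffusion.VagueLimit FracDiffusion.essZeroRight u μ) ∧
      (∀ ν : Measure (EuclideanSpace ℝ (Fin N)), FracDiffusion.IsRadon ν →
        FracDiffusion.VagueLimit FracDiffusion.essZeroRight u ν → ν = μ) ∧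
      μ ∈ FracDiffusion.traceClass N σ m ∧
      ∀ a ∈ FracDiffusion.weightExponents N σ m,
        FracDiffusion.LocL1Weighted T (FracDiffusion.theta a) u →
        Integrable (FracDiffusion.theta a) μ ∧
        (∀ᶠ t in FracDiffusion.essZeroRight,
          Integrable (fun x => u t x * FracDiffusion.theta a x) volume) ∧
        Tendsto (fun t => ∫ x, u t x * FracDiffusion.theta a x) FracDiffusion.essZeroRight
          (𝓝 (∫ x, FracDiffusion.theta a x ∂μ)) ∧
        (FracDiffusion.ContL1Weighted T (FracDiffusion.theta a) u →
          FracDiffusion.VagueLimit (𝓝[>] (0 : ℝ)) u μ ∧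
          Tendsto (fun t => ∫ x, u t x * FracDiffusion.theta a x) (𝓝[>] (0 : ℝ))
            (𝓝 (∫ x, FracDiffusion.theta a x ∂μ))) := by
  obtain ⟨hvw, a₀, ha₀, hw₀⟩ := hu
  have hpos' := FracDiffusion.ae_ae_nonneg hpos
  have hnn : ∀ a ∈ FracDiffusion.weightExponents N σ m, 0 ≤ a := fun a ha =>
    (Nat.cast_nonneg N).trans ha.1.le
  obtain ⟨μ, hμ, hv⟩ := FracDiffusion.exists_initialTrace hN hσ hσ2 hm hm1 hT hvw hpos' ha₀
    (hw₀.bracketWeight_of_theta (hnn a₀ ha₀))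
  refine ⟨μ, ⟨hμ, hv⟩, fun ν hν hvν => FracDiffusion.vagueLimit_unique hμ hν hv hvν,
    ⟨hμ, a₀, ha₀, (FracDiffusion.integrable_theta_and_tendsto hN hσ hσ2 hm hm1 hT hvw hpos' ha₀ hw₀
      hμ hv).1⟩, fun a ha hw => ?_⟩
  -- The convergence theorem accepts any Radon vague limit, so the μ built with a₀ serves every
  -- admissible a.
  obtain ⟨h1, h2⟩ := FracDiffusion.integrable_theta_and_tendsto hN hσ hσ2 hm hm1 hT hvw hpos' ha hw
    hμ hv
  refine ⟨h1, FracDiffusion.eventually_essZeroRight hT hw.ae_integrable, h2, fun hc =>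
    ⟨FracDiffusion.vagueLimit_nhdsGT_of_contL1Weighted hT (hnn a ha) hc hv, ?_⟩⟩
  refine FracDiffusion.tendsto_nhdsGT_of_essZeroRight hT ?_ h2
  exact hc.continuousOn_integral (FracDiffusion.theta_pos a)
    (FracDiffusion.continuous_theta a).measurable (FracDiffusion.continuous_theta a).measurable
    (C := 1) fun x => by rw [abs_of_pos (FracDiffusion.theta_pos a x), one_mul]
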